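/- **Proposition 4.2 (Caccioppoli's inequality).** Let $T>0$, $Q_T=(0,T)\times(0,1)$, $x_0\in(0,1)$, $\lambda\in\mathbb R$, and let $a,b:[0,1]\to\mathbb R$ be continuous with $a(x_0)=b(x_0)=0$ and $a,b>0$ on $[0,1]\setminus\{x_0\}$. *Coefficients.* Call $a$ *weakly degenerate with constant $K$* if $a\in W^{1,1}(0,1)$, $K\in(0,1)$ and $(x-x_0)a'\le Ka$ a.e. in $[0,1]$, and *strongly degenerate with constant $K$* if $a\in W^{1,\infty}(0,1)$, $K\ge 1$ and $(x-x_0)a'\le Ka$ a.e. in $[0,1]$; similarly for $b$. Let $(K_1,K_2)$ be such constants for $(a,b)$; the cases (WWD), (WSD), (SWD), (SSD) are those in which $a,b$ are, respectively, both weakly degenerate; weakly and strongly; strongly and weakly; both strongly degenerate. Put $$H^1_a=\{u\in W^{1,1}_0(0,1):\sqrt a\,u'\in L^2(0,1)\},\qquad \mathcal H=\{u\in H^1_a:\ u/\sqrt b\in L^2(0,1)\},$$ and let $C^*$ be the best constant $C$ in $\int_0^1\frac{u^2}{b}\,dx\le C\int_0^1a(u')^2\,dx$ for all $u\in\mathcal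 H$. Assume that 1. (WWD), (WSD) or (SWD) holds with $K_1+K_2\le2$, and $\lambda\in(0,1/C^*)$; or 2. (WWD), (WSD), (SWD) or (SSD) holds, and $\lambda<0$. *Solutions.* Let $Au=(au')'+\frac{\lambda}{b}u$ with $D(A)=\{u\in H^1_a:\ au'\in H^1(0,1),\ Au\in L^2(0,1)\}$, and $D(A^2)=\{u\in D(A): Au\in D(A)\}$. Let $\mathcal W$ be the set of all weak solutions $v$ of $$v_t+(av_x)_x+\frac{\lambda}{b}v=0\ \text{ in }Q_T,\qquad v(t,0)=v(t,1)=0,\qquad v(T,\cdot)=v_T$$ with $v_T\in D(A^2)$; that is, $v\in L^2(0,T;\mathcal H)\cap H^1([0,T];\mathcal H^*)$, the equation holds in the sense of $\mathcal H^*$-valued distributions, and $v(T,\cdot)=v_T$. *Weight.* Let $\varphi(t,x)=\Theta(t)\Upsilon(x)$ with $\Theta(t)=[t(T-t)]^{-4}$, where $\Upsilon\in C([0,1],(-\infty,0))\cap C^1([0,1]\setminus\{x_0\},(-\infty,0))$ satisfies, for some $c>0$, $|\Upsilon_x|\le c/\sqrt a$ in $[0,1]\setminus\{x_0\}$. *Claim.*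 Let $\omega'\subset\subset\omega\subset(0,1)$ be open intervals, $\omega'$ nonempty, with $x_0\notin\overline{\omega'}$. Then there exist two positive constants $C$ and $s_0$ such that for every $v\in\mathcal W$ and every $s\ge s_0$ the function $(v_x)^2e^{2s\varphi}$ is integrable on $(0,T)\times\omega'$ and $$\int_0^T\!\!\int_{\omega'}(v_x)^2e^{2s\varphi}\,dx\,dt\ \le\ C\int_0^T\!\!\int_{\omega}v^2\,dx\,dt .$$ -/

import Mathlib

open Set Filter Topology MeasureTheory
open scoped ContDiff ENNReal

noncomputable section

namespace SingularDegenerate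

/-- Lebesgue measure on the interval `(0,1)`. -/
def μI : Measure ℝ := volume.restrict (Ioo (0 : ℝ) 1)

/-- Lebesgue measure on the cylinder `Q_T = (0,T) × (0,1)`. -/
def μQ (T : ℝ) : Measure (ℝ × ℝ) := volume.restrict (Ioo (0 : ℝ) T ×ˢ Ioo (0 : ℝ) 1)

/-- The Sobolev space `W^{1,p}(0,1)`, each class being represented by its continuous
representative: the functions that are absolutely continuous on `[0,1]` and whose a.e. derivative
(which is then the weak derivative) belongs to `L^p(0,1)`.  Values outside `[0,1]` are
irrelevant. -/
structure MemW1 (p : ℝ≥0∞) (u : ℝ → ℝ) : Prop where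
  ac : AbsolutelyContinuousOnInterval u 0 1
  deriv_memLp : MemLp (deriv u) p μI

/-- What the four cases of degeneracy have in common: `a` vanishes at `x₀` only, `a ∈ W^{1,p}(0,1)`
and `(x - x₀) a' ≤ K a` almost everywhere. -/
structure IsDegenerate (p : ℝ≥0∞) (x₀ K : ℝ) (a : ℝ → ℝ) : Prop where
  sobolev : MemW1 p a
  zero : a x₀ = 0
  pos : ∀ x ∈ Icc (0 : ℝ) 1, x ≠ x₀ → 0 < a x
  deriv_le : ∀ᵐ x ∂μI, (x - x₀) * deriv a x ≤ K * a x

/-- Weak degeneracy: `a ∈ W^{1,1}(0,1)` and `K ∈ (0,1)`. -/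
def WeaklyDegenerate (x₀ K : ℝ) (a : ℝ → ℝ) : Prop :=
  IsDegenerate 1 x₀ K a ∧ 0 < K ∧ K < 1

/-- Strong degeneracy: `a ∈ W^{1,∞}(0,1)` and `K ≥ 1`. -/
def StronglyDegenerate (x₀ K : ℝ) (a : ℝ → ℝ) : Prop :=
  IsDegenerate ∞ x₀ K a ∧ 1 ≤ K

/-- Doubly weakly degenerate case. -/
def WWD (x₀ K₁ K₂ : ℝ) (a b : ℝ → ℝ) : Prop :=
  WeaklyDegenerate x₀ K₁ a ∧ WeaklyDegenerate x₀ K₂ b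

/-- Weakly-strongly degenerate case. -/
def WSD (x₀ K₁ K₂ : ℝ) (a b : ℝ → ℝ) : Prop :=
  WeaklyDegenerate x₀ K₁ a ∧ StronglyDegenerate x₀ K₂ b

/-- Strongly-weakly degenerate case. -/
def SWD (x₀ K₁ K₂ : ℝ) (a b : ℝ → ℝ) : Prop :=
  StronglyDegenerate x₀ K₁ a ∧ WeaklyDegenerate x₀ K₂ b

/-- Doubly strongly degenerate case. -/
def SSD (x₀ K₁ K₂ : ℝ) (a b : ℝ → ℝ) : Prop :=
  StronglyDegenerate x₀ K₁ a ∧ StronglyDegenerate x₀ K₂ b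

/-- The space `H^1_a(0,1)` of all `u ∈ W^{1,1}_0(0,1)` with `√a u' ∈ L²(0,1)`. -/
structure MemH1a (a u : ℝ → ℝ) : Prop where
  sobolev : MemW1 1 u
  zero_left : u 0 = 0
  zero_right : u 1 = 0
  weighted : MemLp (fun x => √(a x) * deriv u x) 2 μI

/-- The space `ℋ = H^1_{a,b}(0,1)` of all `u ∈ H^1_a(0,1)` with `u / √b ∈ L²(0,1)`. -/
structure MemH (a b u : ℝ → ℝ) : Prop where
  memH1a : MemH1a a u
  singular : MemLp (fun x => u x / √(b x)) 2 μI

/-- The best constant `C*` in the inequality `∫₀¹ u²/b ≤ C ∫₀¹ a (u')²` on `ℋ`.  (If there were no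
admissible constant, the value would be `0` and `1 / C*` would be `0` in Lean, so that no `λ` with
`0 < λ < 1 / C*` would exist, in agreement with the convention `1 / ∞ = 0`.) -/
def bestHardyConst (a b : ℝ → ℝ) : ℝ :=
  sInf {C : ℝ | 0 ≤ C ∧ ∀ u : ℝ → ℝ, MemH a b u →
    ∫ x in (0 : ℝ)..1, u x ^ 2 / b x ≤ C * ∫ x in (0 : ℝ)..1, a x * deriv u x ^ 2}

/-- The standing hypothesis on the coefficients `a`, `b`, the point `x₀` and the parameter `lam`. -/
def StandingHyp (a b : ℝ → ℝ) (x₀ lam : ℝ) : Prop :=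
  0 < x₀ ∧ x₀ < 1 ∧
    ((∃ K₁ K₂ : ℝ, (WWD x₀ K₁ K₂ a b ∨ WSD x₀ K₁ K₂ a b ∨ SWD x₀ K₁ K₂ a b) ∧ K₁ + K₂ ≤ 2 ∧
        0 < lam ∧ lam < 1 / bestHardyConst a b) ∨
      (∃ K₁ K₂ : ℝ, (WWD x₀ K₁ K₂ a b ∨ WSD x₀ K₁ K₂ a b ∨ SWD x₀ K₁ K₂ a b ∨
          SSD x₀ K₁ K₂ a b) ∧ lam < 0))

/-- The graph of the operator `A u = (a u')' + lam u / b` in `L²(0,1)`, with domain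
`D(A) = H^2_{a,b}(0,1)`: `u ∈ H^1_a(0,1)`, `a u'` has a representative `p ∈ H^1(0,1)`, and
`f = p' + lam u / b` almost everywhere, with `f ∈ L²(0,1)`. -/
structure OperatorGraph (a b : ℝ → ℝ) (lam : ℝ) (u f : ℝ → ℝ) : Prop where
  memH1a : MemH1a a u
  flux : ∃ p : ℝ → ℝ, MemW1 2 p ∧ (fun x => a x * deriv u x) =ᵐ[μI] p ∧
    f =ᵐ[μI] fun x => deriv p x + lam * u x / b x
  memLp : MemLp f 2 μI

/-- `u ∈ D(A²)`: `u ∈ D(A)` and `A u ∈ D(A)`. -/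
def MemDomainSq (a b : ℝ → ℝ) (lam : ℝ) (u : ℝ → ℝ) : Prop :=
  ∃ f g : ℝ → ℝ, OperatorGraph a b lam u f ∧ OperatorGraph a b lam f g

/-- The bilinear form of `-A` on `ℋ`, that is `∫₀¹ a u' w' - lam ∫₀¹ u w / b`. -/
def form (a b : ℝ → ℝ) (lam : ℝ) (u w : ℝ → ℝ) : ℝ :=
  ∫ x in (0 : ℝ)..1, (a x * deriv u x * deriv w x - lam * (u x * w x / b x))

/-- `v ∈ L²(0,T;ℋ)`: `v(t,·) ∈ ℋ` for almost every `t`, and the three functions `v`, `√a v_x`,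
`v/√b` that enter the norm of `ℋ` are in `L²(Q_T)`. -/
structure MemL2H (a b : ℝ → ℝ) (T : ℝ) (v : ℝ → ℝ → ℝ) : Prop where
  slice : ∀ᵐ t ∂(volume.restrict (Ioo (0 : ℝ) T)), MemH a b (v t)
  memLp : MemLp (fun q : ℝ × ℝ => v q.1 q.2) 2 (μQ T)
  memLp_deriv : MemLp (fun q : ℝ × ℝ => √(a q.2) * deriv (v q.1) q.2) 2 (μQ T)
  memLp_singular : MemLp (fun q : ℝ × ℝ => v q.1 q.2 / √(b q.2)) 2 (μQ T)

/-- `v` is a (weak) solution of the adjoint problem `v_t + (a v_x)_x + lam v / b = 0` in `Q_T`,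
`v(t,0) = v(t,1) = 0`, `v(T,·) = vT`: it lies in `L²(0,T;ℋ)` and satisfies the equation in the sense
of `ℋ*`-valued distributions, together with the terminal condition.

The test functions in time are smooth and vanish near `t = 0`.  Those which also vanish near `t = T`
express the identity `v_t = form (v(t), ·)` of `ℋ*`-valued distributions on `(0,T)`; its right-hand
side is in `L²(0,T;ℋ*)` because `v ∈ L²(0,T;ℋ)`, so that `v ∈ H^1(0,T;ℋ*)` and `v` has a
representative in `C([0,T];L²(0,1))`.  The others express that this representative equals `vT` at
`t = T`. -/
structure IsAdjointSolution (a b : ℝ → ℝ) (lam T : ℝ) (vT : ℝ → ℝ) (v : ℝ → ℝ → ℝ) : Prop where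
  memL2H : MemL2H a b T v
  equation : ∀ w : ℝ → ℝ, MemH a b w → ∀ η : ℝ → ℝ, ContDiff ℝ ∞ η → tsupport η ⊆ Ioi 0 →
    ∫ t in (0 : ℝ)..T, deriv η t * ∫ x in (0 : ℝ)..1, v t x * w x
      = η T * (∫ x in (0 : ℝ)..1, vT x * w x) - ∫ t in (0 : ℝ)..T, η t * form a b lam (v t) w

/-- The class `𝒲` of the solutions of the adjoint problem with terminal datum in `D(A²)`. -/
def classW (a b : ℝ → ℝ) (lam T : ℝ) : Set (ℝ → ℝ → ℝ) :=
  {v | ∃ vT : ℝ → ℝ, MemDomainSq a b lam vT ∧ IsAdjointSolution a b lam T vT v}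

/-- The weight `Θ(t) = 1 / [t (T - t)]⁴`. -/
def Theta (T t : ℝ) : ℝ := 1 / (t * (T - t)) ^ 4

end SingularDegenerate

end

/-!
Caccioppoli's inequality is an interior estimate, so the degeneracy of the coefficients plays no
role: a cutoff function `ξ` that equals `1` on `ω'` can be supported in an interval of `ω` that
avoids `x₀` and the end points, and there `a` and `b` are bounded below
(`exists_nondegenerateCutoff`).

The formal computation tests `v_t + (a v_x)_x + lam v / b = 0` with `θ(t) ξ² v`, where the weight
`θ` vanishes at both ends of the time interval. Since
`a v_x (ξ² v)_x = a ((ξ v)_x)² - a (ξ' v)²`, the mixed terms cancel, and what remains is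
`∫∫ θ a ((ξ v)_x)² = ∫∫ θ a (ξ' v)² + lam ∫∫ θ (ξ v)² / b - ½ ∫∫ θ' (ξ v)²`,
whose right-hand side is at most a constant times `∫∫_ω v²`.

As `v` is only a weak solution, it is first regularised by convolution in time, which commutes with
the operator because the coefficients do not depend on time. Choosing the kernel itself as test
function in time turns the weak equation into an identity that holds at every time
(`NondegenerateCutoff.energy_identity`); integrating it over time gives an estimate that is uniform
in the kernel, since convolution with a probability density contracts `L²`
(`NondegenerateCutoff.integral_timeConv_cutGrad_le`). The kernels then shrink to a point: the
regularised gradients converge almost everywhere by Lebesgue's differentiation theorem, and Fatou's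
lemma gives the estimate for `v` with weight `t (T - t)`
(`NondegenerateCutoff.integral_cutGrad_le`).

Finally `Υ ≤ -m < 0`, so that `exp (2 s Θ Υ) ≤ exp (-2 m Θ)` for all `s ≥ 1`, and this decays at
both ends of `(0,T)` faster than `t (T - t)` (`exp_weight_le`).
-/

/-! ### Regularisation in time -/

namespace SingularDegenerate

/-- Cauchy-Schwarz for the measure with density `k`. -/
theorem sq_integral_mul_le {α : Type*} [MeasurableSpace α] {ν : Measure α} {k g : α → ℝ}
    (hk : ∀ x, 0 ≤ k x) (h0 : Integrable k ν) (h1 : Integrable (fun x => k x * g x) ν)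
    (h2 : Integrable (fun x => k x * g x ^ 2) ν) :
    (∫ x, k x * g x ∂ν) ^ 2 ≤ (∫ x, k x ∂ν) * ∫ x, k x * g x ^ 2 ∂ν := by
  -- The quadratic polynomial `s ↦ ∫ k (s - g)²` is nonnegative, so its discriminant is `≤ 0`.
  have key : ∀ s : ℝ, 0 ≤ (∫ x, k x ∂ν) * (s * s) + (-2 * ∫ x, k x * g x ∂ν) * s
      + ∫ x, k x * g x ^ 2 ∂ν := by
    intro s
    have e : ∫ x, k x * (s - g x) ^ 2 ∂ν = (∫ x, k x ∂ν) * (s * s)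
        + (-2 * ∫ x, k x * g x ∂ν) * s + ∫ x, k x * g x ^ 2 ∂ν := by
      rw [← integral_const_mul, ← integral_mul_const, ← integral_mul_const, ← integral_add,
        ← integral_add]
      · congr 1; ext x; ring
      · exact (h0.mul_const _).add ((h1.const_mul _).mul_const _)
      · exact h2
      · exact h0.mul_const _
      · exact (h1.const_mul _).mul_const _
    rw [← e]
    exact integral_nonneg fun x => mul_nonneg (hk x) (sq_nonneg _)
  have := discrim_le_zero key
  unfold discrim at this
  nlinarith

/-- Lebesgue measure on the time interval `(0,T)`. -/
noncomputable abbrev timeMeasure (T : ℝ) : Measure ℝ := volume.restrict (Ioo (0 : ℝ) T)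

/-- The convolution in time of `f`, extended by zero outside `(0,T)`, with the kernel `k`. -/
noncomputable def timeConv {X : Type*} (T : ℝ) (k : ℝ → ℝ) (f : ℝ × X → ℝ) (t : ℝ) (x : X) : ℝ :=
  ∫ τ, k (t - τ) * f (τ, x) ∂(timeMeasure T)

theorem timeConv_eq_convolution {X : Type*} (T : ℝ) (k : ℝ → ℝ) (f : ℝ × X → ℝ) (t : ℝ) (x : X) :
    timeConv T k f t x = convolution k ((Ioo 0 T).indicator fun τ => f (τ, x))
      (ContinuousLinearMap.lsmul ℝ ℝ) volume t := by
  rw [convolution_eq_swap, timeConv, ← integral_indicator measurableSet_Ioo]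
  congr 1; ext τ
  by_cases h : τ ∈ Ioo 0 T <;> simp [h]

variable {X : Type*} [MeasurableSpace X] {μ : Measure X} [IsFiniteMeasure μ] {T : ℝ}
  {k : ℝ → ℝ} {f g : ℝ × X → ℝ}

theorem ae_ae_of_ae_prod_right {Y : Type*} [MeasurableSpace Y] {ν : Measure Y} [SFinite ν]
    {p : Y × X → Prop} (h : ∀ᵐ z ∂(ν.prod μ), p z) : ∀ᵐ x ∂μ, ∀ᵐ y ∂ν, p (y, x) := by
  have h' : ∀ᵐ z ∂(μ.prod ν), p z.swap :=
    (Measure.measurePreserving_swap (μ := μ) (ν := ν)).quasiMeasurePreserving.ae h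
  exact Measure.ae_ae_of_ae_prod h'

theorem memLp_slice (hf : MemLp f 2 ((timeMeasure T).prod μ)) :
    ∀ᵐ x ∂μ, MemLp (fun τ => f (τ, x)) 2 (timeMeasure T) := by
  have h1 := hf.integrable_sq.prod_left_ae
  have h2 : ∀ᵐ x ∂μ, AEStronglyMeasurable (fun τ => f (τ, x)) (timeMeasure T) :=
    hf.1.prod_swap.prodMk_left
  filter_upwards [h1, h2] with x a b
  exact (memLp_two_iff_integrable_sq b).2 a

/-- The exceptional set of the space variable does not depend on time, so that the measurable
representative can be used on the cylinder and on each of its time slices. -/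
theorem exists_timeConv_eq_measurable (hk : Continuous k)
    (hf : AEStronglyMeasurable f ((timeMeasure T).prod μ)) :
    ∃ F : ℝ × X → ℝ, Measurable F ∧ ∀ᵐ x ∂μ, ∀ t, timeConv T k f t x = F (t, x) := by
  refine ⟨fun p => timeConv T k (hf.mk f) p.1 p.2, ?_, ?_⟩
  · have hm : Measurable (hf.mk f) := hf.stronglyMeasurable_mk.measurable
    have : StronglyMeasurable (fun p : ℝ × X => ∫ τ, (fun (p : ℝ × X) (τ : ℝ) =>
        k (p.1 - τ) * hf.mk f (τ, p.2)) p τ ∂(timeMeasure T)) := by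
      apply StronglyMeasurable.integral_prod_right
      apply Measurable.stronglyMeasurable
      unfold Function.uncurry
      have := hk.measurable
      fun_prop
    exact this.measurable
  · filter_upwards [ae_ae_of_ae_prod_right hf.ae_eq_mk] with x hx t
    apply integral_congr_ae
    filter_upwards [hx] with τ hτ
    rw [hτ]

theorem aestronglyMeasurable_timeConv (hk : Continuous k)
    (hf : AEStronglyMeasurable f ((timeMeasure T).prod μ)) (ν : Measure ℝ) [SFinite ν] :
    AEStronglyMeasurable (fun p : ℝ × X => timeConv T k f p.1 p.2) (ν.prod μ) := by
  obtain ⟨F, hF, h⟩ := exists_timeConv_eq_measurable hk hf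
  refine ⟨F, hF.stronglyMeasurable, ?_⟩
  filter_upwards [Measure.quasiMeasurePreserving_snd.ae h] with p hp
  exact hp p.1

theorem aestronglyMeasurable_timeConv_slice (hk : Continuous k)
    (hf : AEStronglyMeasurable f ((timeMeasure T).prod μ)) (t : ℝ) :
    AEStronglyMeasurable (timeConv T k f t) μ := by
  obtain ⟨F, hF, h⟩ := exists_timeConv_eq_measurable hk hf
  refine ⟨fun x => F (t, x), (hF.comp measurable_prodMk_left).stronglyMeasurable, ?_⟩
  filter_upwards [h] with x hx
  exact hx t

theorem integrable_kernel_mul {h : ℝ → ℝ} (hk : Continuous k) (hc : HasCompactSupport k)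
    (hh : Integrable h (timeMeasure T)) (t : ℝ) :
    Integrable (fun τ => k (t - τ) * h τ) (timeMeasure T) := by
  obtain ⟨C, hC⟩ := hc.exists_bound_of_continuous hk
  exact hh.bdd_mul (c := C) (by fun_prop) (Eventually.of_forall fun τ => hC _)

/-- The square of a time convolution is bounded, uniformly in time, by an integrable function of
the space variable. -/
theorem exists_timeConv_sq_le (hk : Continuous k) (hc : HasCompactSupport k)
    (hf : MemLp f 2 ((timeMeasure T).prod μ)) :
    ∃ h : X → ℝ, Integrable h μ ∧ ∀ᵐ x ∂μ, ∀ t, timeConv T k f t x ^ 2 ≤ h x := by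
  obtain ⟨C, hC⟩ := hc.exists_bound_of_continuous hk
  refine ⟨fun x => (∫ _, (1 : ℝ) ∂(timeMeasure T)) * (C ^ 2 * ∫ τ, f (τ, x) ^ 2 ∂(timeMeasure T)),
    (hf.integrable_sq.integral_prod_right.const_mul _).const_mul _, ?_⟩
  filter_upwards [memLp_slice hf] with x hx t
  have i2 : Integrable (fun τ => (k (t - τ) * f (τ, x)) ^ 2) (timeMeasure T) := by
    refine (hx.integrable_sq.bdd_mul (f := fun τ => k (t - τ) ^ 2) (c := C ^ 2) (by fun_prop)
      (Eventually.of_forall fun τ => ?_)).congr (Eventually.of_forall fun τ => ?_)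
    · rw [norm_pow]; gcongr; exact hC _
    · simp [mul_pow]
  have i1 := integrable_kernel_mul hk hc (hx.integrable one_le_two) t
  have := sq_integral_mul_le (ν := timeMeasure T) (k := fun _ => (1 : ℝ))
    (g := fun τ => k (t - τ) * f (τ, x)) (fun _ => zero_le_one) (integrable_const _)
    (by simpa using i1) (by simpa using i2)
  simp only [one_mul] at this
  refine this.trans ?_
  refine mul_le_mul_of_nonneg_left ?_ (integral_nonneg fun _ => zero_le_one)
  rw [← integral_const_mul]
  refine integral_mono i2 (hx.integrable_sq.const_mul _) fun τ => ?_
  simp only [mul_pow]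
  refine mul_le_mul_of_nonneg_right ?_ (sq_nonneg _)
  have := hC (t - τ)
  rw [← sq_abs]
  exact pow_le_pow_left₀ (abs_nonneg _) this 2

theorem memLp_timeConv (hk : Continuous k) (hc : HasCompactSupport k)
    (hf : MemLp f 2 ((timeMeasure T).prod μ)) :
    MemLp (fun p : ℝ × X => timeConv T k f p.1 p.2) 2 ((timeMeasure T).prod μ) := by
  have hm := aestronglyMeasurable_timeConv hk hf.1 (timeMeasure T)
  obtain ⟨h, hi, hb⟩ := exists_timeConv_sq_le hk hc hf
  refine (memLp_two_iff_integrable_sq hm).2 ((hi.comp_snd (timeMeasure T)).mono' (hm.pow 2) ?_)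
  filter_upwards [Measure.quasiMeasurePreserving_snd.ae hb] with p hp
  rw [Real.norm_of_nonneg (sq_nonneg _)]
  exact hp p.1

theorem memLp_timeConv_slice (hk : Continuous k) (hc : HasCompactSupport k)
    (hf : MemLp f 2 ((timeMeasure T).prod μ)) (t : ℝ) :
    MemLp (timeConv T k f t) 2 μ := by
  have hm := aestronglyMeasurable_timeConv_slice hk hf.1 t
  obtain ⟨h, hi, hb⟩ := exists_timeConv_sq_le hk hc hf
  refine (memLp_two_iff_integrable_sq hm).2 (hi.mono' (hm.pow 2) ?_)
  filter_upwards [hb] with x hx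
  rw [Real.norm_of_nonneg (sq_nonneg _)]
  exact hx t

/-- Time convolution commutes with pairing in space. -/
theorem integral_kernel_mul_integral (hk : Continuous k) (hc : HasCompactSupport k)
    (hf : MemLp f 2 ((timeMeasure T).prod μ)) {h : X → ℝ} (hh : MemLp h 2 μ) (t : ℝ) :
    ∫ τ, k (t - τ) * ∫ x, f (τ, x) * h x ∂μ ∂(timeMeasure T)
      = ∫ x, timeConv T k f t x * h x ∂μ := by
  obtain ⟨C, hC⟩ := hc.exists_bound_of_continuous hk
  have hi : Integrable (fun p : ℝ × X => f p * h p.2) ((timeMeasure T).prod μ) :=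
    hf.integrable_mul (hh.comp_snd (timeMeasure T))
  have hi' : Integrable (fun p : ℝ × X => k (t - p.1) * (f p * h p.2)) ((timeMeasure T).prod μ) :=
    hi.bdd_mul (c := C)
      (hk.comp (continuous_const.sub continuous_id)).aestronglyMeasurable.comp_fst
      (Eventually.of_forall fun _ => hC _)
  simp_rw [← integral_const_mul]
  rw [integral_integral_swap (f := fun τ x => k (t - τ) * (f (τ, x) * h x)) hi']
  congr 1; ext x
  rw [timeConv, ← integral_mul_const]
  congr 1; ext τ; ring

theorem integral_kernel_comp_sub_le (hk0 : ∀ s, 0 ≤ k s) (hki : Integrable k) (τ : ℝ) (S : Set ℝ) :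
    ∫ t in S, k (t - τ) ≤ ∫ s, k s := by
  rw [← integral_sub_right_eq_self k τ]
  exact setIntegral_le_integral (hki.comp_sub_right τ) (Eventually.of_forall fun _ => hk0 _)

/-- Convolution in time with a probability density is a contraction of `L²`. -/
theorem integral_timeConv_sq_le (hk : Continuous k) (hc : HasCompactSupport k)
    (hk0 : ∀ s, 0 ≤ k s) (hk1 : ∫ s, k s = 1) (hf : MemLp f 2 ((timeMeasure T).prod μ)) :
    ∫ p, timeConv T k f p.1 p.2 ^ 2 ∂((timeMeasure T).prod μ)
      ≤ ∫ p, f p ^ 2 ∂((timeMeasure T).prod μ) := by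
  obtain ⟨C, hC⟩ := hc.exists_bound_of_continuous hk
  have hki : Integrable k := hk.integrable_of_hasCompactSupport hc
  have hU := (memLp_timeConv hk hc hf).integrable_sq
  rw [integral_prod_symm _ hU, integral_prod_symm _ hf.integrable_sq]
  refine integral_mono_ae hU.integral_prod_right hf.integrable_sq.integral_prod_right ?_
  filter_upwards [memLp_slice hf, hU.prod_left_ae] with x hx hUx
  have hj : Integrable (fun q : ℝ × ℝ => k (q.1 - q.2) * f (q.2, x) ^ 2)
      ((timeMeasure T).prod (timeMeasure T)) :=
    (hx.integrable_sq.comp_snd (timeMeasure T)).bdd_mul (c := C)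
      (Continuous.aestronglyMeasurable (by fun_prop)) (Eventually.of_forall fun _ => hC _)
  calc ∫ t, timeConv T k f t x ^ 2 ∂(timeMeasure T)
      ≤ ∫ t, ∫ τ, k (t - τ) * f (τ, x) ^ 2 ∂(timeMeasure T) ∂(timeMeasure T) := by
        refine integral_mono hUx hj.integral_prod_left fun t => ?_
        have hle : ∫ τ, k (t - τ) ∂(timeMeasure T) ≤ 1 := by
          have h := integral_sub_left_eq_self k volume t
          rw [hk1] at h
          rw [← h]
          exact setIntegral_le_integral (hki.comp_sub_left t) (Eventually.of_forall fun _ => hk0 _)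
        have hs := sq_integral_mul_le (ν := timeMeasure T) (k := fun τ => k (t - τ))
          (g := fun τ => f (τ, x)) (fun _ => hk0 _) (hki.comp_sub_left t).restrict
          (integrable_kernel_mul hk hc (hx.integrable one_le_two) t)
          (integrable_kernel_mul hk hc hx.integrable_sq t)
        exact hs.trans (mul_le_of_le_one_left
          (integral_nonneg fun τ => mul_nonneg (hk0 _) (sq_nonneg _)) hle)
    _ = ∫ τ, (∫ t, k (t - τ) ∂(timeMeasure T)) * f (τ, x) ^ 2 ∂(timeMeasure T) := by
        rw [integral_integral_swap hj]
        simp_rw [integral_mul_const]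
    _ ≤ ∫ τ, f (τ, x) ^ 2 ∂(timeMeasure T) := by
        refine integral_mono ?_ hx.integrable_sq fun τ => ?_
        · have := hj.integral_prod_right
          simpa only [integral_mul_const] using this
        · exact mul_le_of_le_one_left (sq_nonneg _)
            (hk1 ▸ integral_kernel_comp_sub_le hk0 hki τ _)

theorem hasDerivAt_timeConv (hk : ContDiff ℝ 1 k) (hc : HasCompactSupport k)
    (hf : MemLp f 2 ((timeMeasure T).prod μ)) :
    ∀ᵐ x ∂μ, ∀ t, HasDerivAt (fun t => timeConv T k f t x) (timeConv T (deriv k) f t x) t := by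
  filter_upwards [memLp_slice hf] with x hx t
  have hl : LocallyIntegrable ((Ioo 0 T).indicator fun τ => f (τ, x)) volume :=
    (IntegrableOn.integrable_indicator (hx.integrable one_le_two)
      measurableSet_Ioo).locallyIntegrable
  simp_rw [timeConv_eq_convolution]
  exact hc.hasDerivAt_convolution_left _ hk hl t

theorem tendsto_timeConv (hf : MemLp f 2 ((timeMeasure T).prod μ)) {φ : ℕ → ContDiffBump (0 : ℝ)}
    {K : ℝ} (hφ : Tendsto (fun i => (φ i).rOut) atTop (𝓝 0))
    (h'φ : ∀ i, (φ i).rOut ≤ K * (φ i).rIn) :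
    ∀ᵐ x ∂μ, ∀ᵐ t ∂(timeMeasure T),
      Tendsto (fun i => timeConv T ((φ i).normed volume) f t x) atTop (𝓝 (f (t, x))) := by
  filter_upwards [memLp_slice hf] with x hx
  have hl : LocallyIntegrable ((Ioo 0 T).indicator fun τ => f (τ, x)) volume :=
    (IntegrableOn.integrable_indicator (hx.integrable one_le_two)
      measurableSet_Ioo).locallyIntegrable
  have := ContDiffBump.ae_convolution_tendsto_right_of_locallyIntegrable hφ
    (Eventually.of_forall h'φ) hl
  filter_upwards [ae_restrict_of_ae this, ae_restrict_mem measurableSet_Ioo] with t ht hm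
  simp_rw [timeConv_eq_convolution]
  rwa [indicator_of_mem hm] at ht

end SingularDegenerate

/-! ### Localised solutions and the energy identity -/

namespace SingularDegenerate

instance : IsFiniteMeasure μI := by unfold μI; infer_instance

theorem μQ_eq_prod (T : ℝ) : μQ T = (timeMeasure T).prod μI := by
  rw [μQ, μI, Measure.prod_restrict, Measure.volume_eq_prod]

theorem ae_mem_μI : ∀ᵐ x ∂μI, x ∈ Ioo (0 : ℝ) 1 := ae_restrict_mem measurableSet_Ioo

theorem intervalIntegral_eq_μI (h : ℝ → ℝ) : ∫ x in (0 : ℝ)..1, h x = ∫ x, h x ∂μI := by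
  rw [intervalIntegral.integral_of_le zero_le_one, integral_Ioc_eq_integral_Ioo, μI]

theorem memLp_bdd_mul {α : Type*} [MeasurableSpace α] {ν : Measure α} {p : ℝ≥0∞} {m f : α → ℝ}
    {C : ℝ} (hf : MemLp f p ν) (hm : AEStronglyMeasurable m ν) (hC : ∀ᵐ x ∂ν, |m x| ≤ C) :
    MemLp (fun x => m x * f x) p ν := by
  refine hf.of_le_mul (c := C) (hm.mul hf.1) ?_
  filter_upwards [hC] with x hx
  rw [norm_mul]
  exact mul_le_mul_of_nonneg_right hx (norm_nonneg _)

theorem aestronglyMeasurable_μI {h : ℝ → ℝ} (hh : ContinuousOn h (Icc 0 1)) :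
    AEStronglyMeasurable h μI :=
  (hh.mono Ioo_subset_Icc_self).aestronglyMeasurable measurableSet_Ioo

/-- A multiplier need only be bounded where the function is not zero; this is how the cutoff
removes the singularities of `1 / b` and `1 / √b`. -/
theorem memLp_mul_of_bddOn {l r : ℝ} {m : ℝ → ℝ}
    (hm : AEStronglyMeasurable m μI) {c : ℝ} (hmc : ∀ x ∈ Icc l r, |m x| ≤ c)
    {u : ℝ → ℝ} (hu : MemLp u 2 μI) (hu0 : ∀ᵐ x ∂μI, x ∉ Icc l r → u x = 0) :
    MemLp (fun x => u x * m x) 2 μI := by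
  refine hu.of_le_mul (c := c) (hu.1.mul hm) ?_
  filter_upwards [hu0] with x hx
  by_cases hxm : x ∈ Icc l r
  · rw [norm_mul, mul_comm]
    exact mul_le_mul_of_nonneg_right (hmc x hxm) (norm_nonneg _)
  · simp [hx hxm]

/-- A smooth cutoff function `ξ`, supported in an interval `[l, r] ⊆ (0,1)` on which the
coefficients `a` and `b` are nondegenerate, together with the quantitative bounds that determine
the constant in the localised energy estimate. -/
structure NondegenerateCutoff (a b ξ : ℝ → ℝ) (l r A a₀ b₀ D : ℝ) : Prop where
  smooth : ContDiff ℝ ∞ ξ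
  left_pos : 0 < l
  right_lt : r < 1
  eq_zero : ∀ x ∉ Icc l r, ξ x = 0
  deriv_eq_zero : ∀ x ∉ Icc l r, deriv ξ x = 0
  abs_le : ∀ x, |ξ x| ≤ 1
  deriv_le : ∀ x, |deriv ξ x| ≤ D
  continuousOn_a : ContinuousOn a (Icc 0 1)
  continuousOn_b : ContinuousOn b (Icc 0 1)
  a_nonneg : ∀ x ∈ Icc (0 : ℝ) 1, 0 ≤ a x
  a_le : ∀ x ∈ Icc (0 : ℝ) 1, a x ≤ A
  a₀_pos : 0 < a₀
  b₀_pos : 0 < b₀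
  le_a : ∀ x ∈ Icc l r, a₀ ≤ a x
  le_b : ∀ x ∈ Icc l r, b₀ ≤ b x

/-- The function `ζ v`, as a function on the cylinder. -/
def cutVal (ζ : ℝ → ℝ) (v : ℝ → ℝ → ℝ) (q : ℝ × ℝ) : ℝ := ζ q.2 * v q.1 q.2

/-- The function `ξ v_x`, as a function on the cylinder. -/
noncomputable def cutDeriv (ξ : ℝ → ℝ) (v : ℝ → ℝ → ℝ) (q : ℝ × ℝ) : ℝ := ξ q.2 * deriv (v q.1) q.2

/-- The derivative `(ξ v)_x = ξ' v + ξ v_x`, as a function on the cylinder. -/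
noncomputable def cutGrad (ξ : ℝ → ℝ) (v : ℝ → ℝ → ℝ) (q : ℝ × ℝ) : ℝ :=
  cutVal (deriv ξ) v q + cutDeriv ξ v q

theorem timeConv_cutVal (T : ℝ) (k ζ : ℝ → ℝ) (v : ℝ → ℝ → ℝ) (t x : ℝ) :
    timeConv T k (cutVal ζ v) t x = ζ x * timeConv T k (fun q => v q.1 q.2) t x := by
  rw [timeConv, timeConv, ← integral_const_mul]
  congr 1; ext τ; simp only [cutVal]; ring

variable {a b ξ k : ℝ → ℝ} {l r A a₀ b₀ D T lam ε : ℝ} {v : ℝ → ℝ → ℝ} {vT : ℝ → ℝ}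

theorem memLp_cutVal {ζ : ℝ → ℝ} {C : ℝ} (hζ : Continuous ζ) (hC : ∀ x, |ζ x| ≤ C)
    (hv : MemL2H a b T v) : MemLp (cutVal ζ v) 2 ((timeMeasure T).prod μI) := by
  rw [← μQ_eq_prod]
  exact memLp_bdd_mul (m := fun q : ℝ × ℝ => ζ q.2) hv.memLp
    (Continuous.aestronglyMeasurable (by fun_prop)) (Eventually.of_forall fun q => hC q.2)

/-- The function used to test the equation at time `t`: the cutoff `ξ` times the regularisation in
time of `ξ v`, the latter being written as a primitive. -/
noncomputable def testFun (T : ℝ) (k ξ : ℝ → ℝ) (v : ℝ → ℝ → ℝ)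
    (t x : ℝ) : ℝ :=
  ξ x * ∫ y in (0 : ℝ)..x, timeConv T k (cutGrad ξ v) t y

/-- The weak equation, tested in time with the kernel `k (t - ·)`. -/
theorem IsAdjointSolution.kernel_equation
    (hv : IsAdjointSolution a b lam T vT v) (hT : 0 < T) (hk : ContDiff ℝ ∞ k)
    (hkε : ∀ s, ε < |s| → k s = 0) {t : ℝ} (ht : t ∈ Ioo ε (T - ε)) {w : ℝ → ℝ} (hw : MemH a b w) :
    ∫ τ, deriv k (t - τ) * ∫ x, v τ x * w x ∂μI ∂(timeMeasure T)
      = ∫ τ, k (t - τ) * form a b lam (v τ) w ∂(timeMeasure T) := by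
  have hs : tsupport (fun τ => k (t - τ)) ⊆ Ioi 0 := by
    have h1 : tsupport (fun τ => k (t - τ)) ⊆ Icc (t - ε) (t + ε) := by
      refine closure_minimal (fun τ hτ => ?_) isClosed_Icc
      have : |t - τ| ≤ ε := by
        by_contra h
        exact hτ (hkε _ (not_le.1 h))
      rw [abs_le] at this
      constructor <;> linarith
    exact h1.trans fun τ hτ => by
      have := ht.1
      exact lt_of_lt_of_le (by linarith) hτ.1
  have h := hv.equation w hw (fun τ => k (t - τ)) (hk.comp (contDiff_const.sub contDiff_id)) hs
  have hT0 : k (t - T) = 0 := hkε _ (by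
    rw [abs_sub_comm]
    exact lt_of_lt_of_le (by linarith [ht.2]) (le_abs_self _))
  have hd : ∀ τ, deriv (fun τ => k (t - τ)) τ = -deriv k (t - τ) := fun τ =>
    deriv_comp_const_sub _ _ _
  simp only [hT0, zero_mul, zero_sub, hd, neg_mul, intervalIntegral.integral_neg, neg_inj,
    intervalIntegral_eq_μI] at h
  simpa only [intervalIntegral.integral_of_le hT.le, integral_Ioc_eq_integral_Ioo] using h

namespace NondegenerateCutoff

theorem continuous (hξ : NondegenerateCutoff a b ξ l r A a₀ b₀ D) : Continuous ξ :=
  hξ.smooth.continuous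

theorem continuous_deriv (hξ : NondegenerateCutoff a b ξ l r A a₀ b₀ D) : Continuous (deriv ξ) :=
  hξ.smooth.continuous_deriv (by simp)

theorem memLp_cutDeriv (hξ : NondegenerateCutoff a b ξ l r A a₀ b₀ D) (hv : MemL2H a b T v) :
    MemLp (cutDeriv ξ v) 2 ((timeMeasure T).prod μI) := by
  have h1 := hv.memLp_deriv
  rw [μQ_eq_prod] at h1
  have hm : AEStronglyMeasurable (fun x => ξ x * (√(a x))⁻¹) μI :=
    hξ.continuous.aestronglyMeasurable.mul
      (aestronglyMeasurable_μI hξ.continuousOn_a.sqrt).aemeasurable.inv.aestronglyMeasurable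
  have hb : ∀ x, |ξ x * (√(a x))⁻¹| ≤ (√a₀)⁻¹ := by
    intro x
    by_cases hx : x ∈ Icc l r
    · rw [abs_mul, abs_inv, abs_of_nonneg (Real.sqrt_nonneg _)]
      have : 0 < √a₀ := Real.sqrt_pos.2 hξ.a₀_pos
      have h2 : (√(a x))⁻¹ ≤ (√a₀)⁻¹ :=
        inv_anti₀ this (Real.sqrt_le_sqrt (hξ.le_a x hx))
      calc |ξ x| * (√(a x))⁻¹ ≤ 1 * (√a₀)⁻¹ :=
            mul_le_mul (hξ.abs_le x) h2 (by positivity) zero_le_one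
        _ = _ := one_mul _
    · rw [hξ.eq_zero x hx]; simp
  refine (memLp_congr_ae (Eventually.of_forall fun q => ?_)).2
    (memLp_bdd_mul h1 (m := fun q : ℝ × ℝ => ξ q.2 * (√(a q.2))⁻¹) hm.comp_snd
      (Eventually.of_forall fun q => hb q.2))
  simp only [cutDeriv]
  by_cases hx : q.2 ∈ Icc l r
  · have : 0 < √(a q.2) := Real.sqrt_pos.2 (hξ.a₀_pos.trans_le (hξ.le_a _ hx))
    field_simp
  · simp [hξ.eq_zero _ hx]

theorem memLp_cutGrad (hξ : NondegenerateCutoff a b ξ l r A a₀ b₀ D) (hv : MemL2H a b T v) :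
    MemLp (cutGrad ξ v) 2 ((timeMeasure T).prod μI) :=
  (memLp_cutVal hξ.continuous_deriv hξ.deriv_le hv).add (hξ.memLp_cutDeriv hv)

theorem absolutelyContinuous (hξ : NondegenerateCutoff a b ξ l r A a₀ b₀ D) :
    AbsolutelyContinuousOnInterval ξ 0 1 :=
  ContDiffOn.absolutelyContinuousOnInterval (hξ.smooth.of_le (by simp)).contDiffOn

theorem map_zero (hξ : NondegenerateCutoff a b ξ l r A a₀ b₀ D) : ξ 0 = 0 :=
  hξ.eq_zero 0 fun h => absurd h.1 (not_le.2 hξ.left_pos)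

theorem map_one (hξ : NondegenerateCutoff a b ξ l r A a₀ b₀ D) : ξ 1 = 0 :=
  hξ.eq_zero 1 fun h => absurd h.2 (not_le.2 hξ.right_lt)

theorem mul_eq_integral (hξ : NondegenerateCutoff a b ξ l r A a₀ b₀ D) (hv : MemL2H a b T v) :
    ∀ᵐ t ∂(timeMeasure T), ∀ x ∈ Icc (0 : ℝ) 1,
      ξ x * v t x = ∫ y in (0 : ℝ)..x, cutGrad ξ v (t, y) := by
  filter_upwards [hv.slice] with t ht x hx
  have hac := (hξ.absolutelyContinuous.fun_mul ht.memH1a.sobolev.ac)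
  have hsub : uIcc 0 x ⊆ uIcc (0 : ℝ) 1 := by
    rw [uIcc_of_le hx.1, uIcc_of_le zero_le_one]; exact Icc_subset_Icc_right hx.2
  have h1 := (hac.mono hsub).integral_deriv_eq_sub
  rw [hξ.map_zero, zero_mul, sub_zero] at h1
  rw [← h1]
  apply intervalIntegral.integral_congr_ae
  filter_upwards [ht.memH1a.sobolev.ac.ae_differentiableAt] with y hy hyx
  have hd := hy (hsub (uIoc_subset_uIcc hyx))
  have := ((hξ.smooth.differentiable (by simp)) y).hasDerivAt.mul hd.hasDerivAt
  exact this.deriv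

theorem timeConv_cutVal_eq_integral (hξ : NondegenerateCutoff a b ξ l r A a₀ b₀ D)
    (hv : MemL2H a b T v) (hk : Continuous k) (hc : HasCompactSupport k) (t : ℝ) {x : ℝ}
    (hx : x ∈ Icc (0 : ℝ) 1) :
    timeConv T k (cutVal ξ v) t x = ∫ y in (0 : ℝ)..x, timeConv T k (cutGrad ξ v) t y := by
  -- A primitive is a pairing with an indicator function, hence commutes with time convolution.
  have key : ∀ h : ℝ → ℝ, ∫ y in (0 : ℝ)..x, h y = ∫ y, h y * (Iic x).indicator 1 y ∂μI := by
    intro h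
    have e : (fun y => h y * (Iic x).indicator (1 : ℝ → ℝ) y) = (Iic x).indicator h := by
      ext y
      by_cases hy : y ∈ Iic x <;> simp [hy]
    rw [e, integral_indicator measurableSet_Iic, intervalIntegral.integral_of_le hx.1, μI,
      Measure.restrict_restrict measurableSet_Iic,
      ← restrict_Ioo_eq_restrict_Ioc (a := 0) (b := x)]
    have : (Ioo 0 x : Set ℝ) =ᵐ[volume] (Iic x ∩ Ioo 0 1 : Set ℝ) := by
      have hne : ∀ᵐ y : ℝ, y ≠ x := by simp [ae_iff]
      filter_upwards [hne] with y hy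
      apply propext
      change y ∈ Ioo 0 x ↔ y ∈ Iic x ∩ Ioo 0 1
      simp only [mem_Ioo, mem_inter_iff, mem_Iic]
      exact ⟨fun h => ⟨h.2.le, h.1, h.2.trans_le hx.2⟩, fun h => ⟨h.2.1, lt_of_le_of_ne h.1 hy⟩⟩
    rw [Measure.restrict_congr_set this]
  have hh : MemLp ((Iic x).indicator (1 : ℝ → ℝ)) 2 μI :=
    (memLp_const (1 : ℝ)).indicator measurableSet_Iic
  rw [key, ← integral_kernel_mul_integral hk hc (hξ.memLp_cutGrad hv) hh, timeConv]
  apply integral_congr_ae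
  filter_upwards [hξ.mul_eq_integral hv] with τ hτ
  rw [← key, ← hτ x hx, cutVal]

theorem testFun_eq (hξ : NondegenerateCutoff a b ξ l r A a₀ b₀ D)
    (hv : MemL2H a b T v) (hk : Continuous k) (hc : HasCompactSupport k) (t : ℝ) {x : ℝ}
    (hx : x ∈ Icc (0 : ℝ) 1) :
    testFun T k ξ v t x = ξ x * timeConv T k (cutVal ξ v) t x := by
  rw [testFun, hξ.timeConv_cutVal_eq_integral hv hk hc t hx]

theorem intervalIntegrable_timeConv (hξ : NondegenerateCutoff a b ξ l r A a₀ b₀ D)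
    (hv : MemL2H a b T v) (hk : Continuous k) (hc : HasCompactSupport k) (t : ℝ) :
    IntervalIntegrable (timeConv T k (cutGrad ξ v) t) volume 0 1 := by
  rw [intervalIntegrable_iff_integrableOn_Ioo_of_le zero_le_one]
  exact (memLp_timeConv_slice hk hc (hξ.memLp_cutGrad hv) t).integrable one_le_two

/-- Since `ξ' (ξ v) = ξ (ξ' v)`, the derivative of the test function has the factor `ξ`. -/
theorem deriv_testFun (hξ : NondegenerateCutoff a b ξ l r A a₀ b₀ D)
    (hv : MemL2H a b T v) (hk : Continuous k) (hc : HasCompactSupport k) (t : ℝ) :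
    ∀ᵐ x ∂μI, deriv (testFun T k ξ v t) x
      = ξ x * (timeConv T k (cutVal (deriv ξ) v) t x + timeConv T k (cutGrad ξ v) t x) := by
  filter_upwards [ae_restrict_of_ae
    (hξ.intervalIntegrable_timeConv hv hk hc t).ae_hasDerivAt_integral, ae_mem_μI] with x hx hm
  have hx' := hx (by rw [uIcc_of_le zero_le_one]; exact Ioo_subset_Icc_self hm) 0 (by simp)
  have := (((hξ.smooth.differentiable (by simp)) x).hasDerivAt.mul hx').deriv
  refine this.trans ?_
  rw [← hξ.timeConv_cutVal_eq_integral hv hk hc t (Ioo_subset_Icc_self hm), timeConv_cutVal,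
    timeConv_cutVal]
  ring

theorem memLp_timeConv_div (hξ : NondegenerateCutoff a b ξ l r A a₀ b₀ D)
    (hv : MemL2H a b T v) (hk : Continuous k) (hc : HasCompactSupport k) (t : ℝ) :
    MemLp (fun x => timeConv T k (cutVal ξ v) t x / b x) 2 μI := by
  simp_rw [div_eq_mul_inv]
  refine memLp_mul_of_bddOn
    (aestronglyMeasurable_μI hξ.continuousOn_b).aemeasurable.inv.aestronglyMeasurable
    (c := b₀⁻¹) (fun x hx => ?_)
    (memLp_timeConv_slice hk hc (memLp_cutVal hξ.continuous hξ.abs_le hv) t)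
    (Eventually.of_forall fun x hx => by rw [timeConv_cutVal, hξ.eq_zero x hx, zero_mul])
  rw [Pi.inv_apply, abs_inv, abs_of_pos (hξ.b₀_pos.trans_le (hξ.le_b x hx))]
  exact inv_anti₀ hξ.b₀_pos (hξ.le_b x hx)

theorem memH_testFun (hξ : NondegenerateCutoff a b ξ l r A a₀ b₀ D)
    (hv : MemL2H a b T v) (hk : Continuous k) (hc : HasCompactSupport k) (t : ℝ) :
    MemH a b (testFun T k ξ v t) := by
  have hU := memLp_timeConv_slice hk hc (memLp_cutVal hξ.continuous hξ.abs_le hv) t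
  have hQ := memLp_timeConv_slice hk hc (memLp_cutVal hξ.continuous_deriv hξ.deriv_le hv) t
  have hG := memLp_timeConv_slice hk hc (hξ.memLp_cutGrad hv) t
  have hd : MemLp (deriv (testFun T k ξ v t)) 2 μI :=
    (memLp_congr_ae (hξ.deriv_testFun hv hk hc t)).2
      (memLp_bdd_mul (hQ.add hG) hξ.continuous.aestronglyMeasurable
        (Eventually.of_forall hξ.abs_le))
  refine ⟨⟨⟨?_, hd.mono_exponent one_le_two⟩, ?_, ?_, ?_⟩, ?_⟩
  · exact hξ.absolutelyContinuous.fun_mul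
      ((hξ.intervalIntegrable_timeConv hv hk hc t).absolutelyContinuousOnInterval_intervalIntegral
        (by simp))
  · simp [testFun]
  · simp [testFun, hξ.map_one]
  · refine memLp_bdd_mul (C := √A) hd (aestronglyMeasurable_μI hξ.continuousOn_a.sqrt) ?_
    filter_upwards [ae_mem_μI] with x hx
    rw [abs_of_nonneg (Real.sqrt_nonneg _)]
    exact Real.sqrt_le_sqrt (hξ.a_le x (Ioo_subset_Icc_self hx))
  · have hw : MemLp (testFun T k ξ v t) 2 μI := by
      refine (memLp_congr_ae ?_).2 (memLp_bdd_mul hU hξ.continuous.aestronglyMeasurable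
        (Eventually.of_forall hξ.abs_le))
      filter_upwards [ae_mem_μI] with x hx
      exact hξ.testFun_eq hv hk hc t (Ioo_subset_Icc_self hx)
    simp_rw [div_eq_mul_inv]
    refine memLp_mul_of_bddOn (c := (√b₀)⁻¹)
      (aestronglyMeasurable_μI hξ.continuousOn_b.sqrt).aemeasurable.inv.aestronglyMeasurable
      (fun x hx => ?_) hw
      (Eventually.of_forall fun x hx => by rw [testFun, hξ.eq_zero x hx, zero_mul])
    rw [Pi.inv_apply, abs_inv, abs_of_nonneg (Real.sqrt_nonneg _)]
    exact inv_anti₀ (Real.sqrt_pos.2 hξ.b₀_pos) (Real.sqrt_le_sqrt (hξ.le_b x hx))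

/-- The localised energy identity.  With `U`, `Q`, `G` the regularisations in time of `ξ v`, `ξ' v`
and `(ξ v)_x`, testing the equation with `ξ U` gives `∫ U U_t = ∫ a (G² - Q²) - lam ∫ U² / b`: the
mixed terms cancel. -/
theorem energy_identity (hξ : NondegenerateCutoff a b ξ l r A a₀ b₀ D)
    (hv : IsAdjointSolution a b lam T vT v) (hT : 0 < T) (hk : ContDiff ℝ ∞ k)
    (hc : HasCompactSupport k) (hkε : ∀ s, ε < |s| → k s = 0) {t : ℝ} (ht : t ∈ Ioo ε (T - ε)) :
    ∫ x, timeConv T (deriv k) (cutVal ξ v) t x * timeConv T k (cutVal ξ v) t x ∂μI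
      = ∫ x, (a x * timeConv T k (cutGrad ξ v) t x ^ 2
          - a x * timeConv T k (cutVal (deriv ξ) v) t x ^ 2
          - lam * (timeConv T k (cutVal ξ v) t x ^ 2 / b x)) ∂μI := by
  have hkc := hk.continuous
  have hL := hv.memL2H
  have hdk : Continuous (deriv k) := hk.continuous_deriv (by simp)
  have hq1 := memLp_cutVal hξ.continuous hξ.abs_le hL
  have hq2 := memLp_cutVal hξ.continuous_deriv hξ.deriv_le hL
  have hg := hξ.memLp_cutGrad hL
  have hp := hξ.memLp_cutDeriv hL
  have hU := memLp_timeConv_slice hkc hc hq1 t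
  have hQ := memLp_timeConv_slice hkc hc hq2 t
  have hG := memLp_timeConv_slice hkc hc hg t
  have hP := memLp_timeConv_slice hkc hc hp t
  have hUb := hξ.memLp_timeConv_div hL hkc hc t
  have haQG : MemLp (fun x => a x * (timeConv T k (cutVal (deriv ξ) v) t x
      + timeConv T k (cutGrad ξ v) t x)) 2 μI := by
    refine memLp_bdd_mul (C := A) (hQ.add hG) (aestronglyMeasurable_μI hξ.continuousOn_a) ?_
    filter_upwards [ae_mem_μI] with x hx
    have hx := Ioo_subset_Icc_self hx
    rw [abs_of_nonneg (hξ.a_nonneg x hx)]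
    exact hξ.a_le x hx
  have heq := hv.kernel_equation hT hk hkε ht (hξ.memH_testFun hL hkc hc t)
  have hlhs : ∀ τ, ∫ x, v τ x * testFun T k ξ v t x ∂μI
      = ∫ x, cutVal ξ v (τ, x) * timeConv T k (cutVal ξ v) t x ∂μI := by
    intro τ
    apply integral_congr_ae
    filter_upwards [ae_mem_μI] with x hx
    rw [hξ.testFun_eq hL hkc hc t (Ioo_subset_Icc_self hx), cutVal]
    ring
  simp_rw [hlhs] at heq
  rw [integral_kernel_mul_integral hdk hc.deriv hq1 hU] at heq
  rw [heq]
  have hi1 : Integrable (fun p : ℝ × ℝ => cutDeriv ξ v p * (a p.2 *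
      (timeConv T k (cutVal (deriv ξ) v) t p.2 + timeConv T k (cutGrad ξ v) t p.2)))
      ((timeMeasure T).prod μI) := hp.integrable_mul (haQG.comp_snd (timeMeasure T))
  have hi2 : Integrable (fun p : ℝ × ℝ => cutVal ξ v p * (timeConv T k (cutVal ξ v) t p.2 / b p.2))
      ((timeMeasure T).prod μI) := hq1.integrable_mul (hUb.comp_snd (timeMeasure T))
  have hform : ∀ᵐ τ ∂(timeMeasure T), k (t - τ) * form a b lam (v τ) (testFun T k ξ v t)
      = k (t - τ) * (∫ x, cutDeriv ξ v (τ, x) * (a x *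
          (timeConv T k (cutVal (deriv ξ) v) t x + timeConv T k (cutGrad ξ v) t x)) ∂μI)
        - lam * (k (t - τ) *
          ∫ x, cutVal ξ v (τ, x) * (timeConv T k (cutVal ξ v) t x / b x) ∂μI) := by
    filter_upwards [hi1.prod_right_ae, hi2.prod_right_ae] with τ h1 h2
    have : form a b lam (v τ) (testFun T k ξ v t) = (∫ x, cutDeriv ξ v (τ, x) * (a x *
          (timeConv T k (cutVal (deriv ξ) v) t x + timeConv T k (cutGrad ξ v) t x)) ∂μI)
        - lam * ∫ x, cutVal ξ v (τ, x) * (timeConv T k (cutVal ξ v) t x / b x) ∂μI := by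
      rw [form, intervalIntegral_eq_μI, ← integral_const_mul, ← integral_sub h1 (h2.const_mul _)]
      apply integral_congr_ae
      filter_upwards [ae_mem_μI, hξ.deriv_testFun hL hkc hc t] with x hx hdx
      rw [hξ.testFun_eq hL hkc hc t (Ioo_subset_Icc_self hx), hdx, cutVal, cutDeriv]
      ring
    rw [this]; ring
  rw [integral_congr_ae hform, integral_sub, integral_const_mul,
    integral_kernel_mul_integral hkc hc hp haQG, integral_kernel_mul_integral hkc hc hq1 hUb,
    ← integral_const_mul, ← integral_sub]
  · apply integral_congr_ae
    filter_upwards [memLp_slice hq2, memLp_slice hp] with x h2 h3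
    have hadd : timeConv T k (cutGrad ξ v) t x
        = timeConv T k (cutVal (deriv ξ) v) t x + timeConv T k (cutDeriv ξ v) t x := by
      rw [timeConv, timeConv, timeConv, ← integral_add]
      · congr 1; ext τ; rw [cutGrad]; ring
      · exact integrable_kernel_mul hkc hc (h2.integrable one_le_two) t
      · exact integrable_kernel_mul hkc hc (h3.integrable one_le_two) t
    rw [hadd]; ring
  · exact hP.integrable_mul haQG
  · exact (hU.integrable_mul hUb).const_mul _
  · exact integrable_kernel_mul hkc hc hi1.integral_prod_left t
  · exact (integrable_kernel_mul hkc hc hi2.integral_prod_left t).const_mul _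

end NondegenerateCutoff

end SingularDegenerate

/-! ### Interior gradient estimate -/

namespace SingularDegenerate

/-- The weight in time `(t - ε) (T - ε - t)`, cut off at zero outside `(ε, T - ε)`. -/
noncomputable def timeWeight (T ε t : ℝ) : ℝ := max ((t - ε) * (T - ε - t)) 0

theorem timeWeight_nonneg (T ε t : ℝ) : 0 ≤ timeWeight T ε t := le_max_right _ _

theorem continuous_timeWeight (T ε : ℝ) : Continuous (timeWeight T ε) := by
  unfold timeWeight; fun_prop

theorem timeWeight_le {T ε t : ℝ} (hε : 0 ≤ ε) (hεT : ε ≤ T - ε) :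
    timeWeight T ε t ≤ T ^ 2 := by
  refine max_le ?_ (sq_nonneg _)
  nlinarith [sq_nonneg (t - ε - (T - ε - t)), mul_nonneg hε (sub_nonneg.2 hεT)]

theorem timeWeight_eq_zero {T ε t : ℝ} (hε : ε < T - ε) (ht : t ∉ Ioo ε (T - ε)) :
    timeWeight T ε t = 0 := by
  refine max_eq_right ?_
  rw [mem_Ioo, not_and_or, not_lt, not_lt] at ht
  rcases ht with h | h
  · exact mul_nonpos_of_nonpos_of_nonneg (by linarith) (by linarith)
  · exact mul_nonpos_of_nonneg_of_nonpos (by linarith) (by linarith)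

/-- Integration by parts in time against the weight, which vanishes at both ends. -/
theorem integral_timeWeight_mul_le {T ε : ℝ} (hε : 0 < ε) (hεT : ε < T - ε) {u u' : ℝ → ℝ}
    (hu : ∀ t, HasDerivAt u (u' t) t) (hu' : Continuous u') :
    ∫ t, timeWeight T ε t * (u' t * u t) ∂(timeMeasure T)
      ≤ T / 2 * ∫ t, u t ^ 2 ∂(timeMeasure T) := by
  have hc : Continuous u := continuous_iff_continuousAt.2 fun t => (hu t).continuousAt
  have hsub : Ioo ε (T - ε) ⊆ Ioo 0 T := Ioo_subset_Ioo hε.le (by linarith)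
  have hint : Integrable (fun t => u t ^ 2) (timeMeasure T) :=
    ((hc.pow 2).integrableOn_Icc (a := 0) (b := T)).mono_set Ioo_subset_Icc_self
  have h1 : ∫ t, timeWeight T ε t * (u' t * u t) ∂(timeMeasure T)
      = ∫ t in ε..(T - ε), ((t - ε) * (T - ε - t)) * (u' t * u t) := by
    rw [intervalIntegral.integral_of_le hεT.le, integral_Ioc_eq_integral_Ioo,
      setIntegral_eq_of_subset_of_forall_sdiff_eq_zero (t := Ioo 0 T) measurableSet_Ioo hsub
        (f := fun t => timeWeight T ε t * (u' t * u t))]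
    · refine setIntegral_congr_fun measurableSet_Ioo fun t ht => ?_
      simp only [timeWeight]
      rw [max_eq_left]
      exact mul_nonneg (by linarith [ht.1]) (by linarith [ht.2])
    · intro t ht
      rw [timeWeight_eq_zero hεT ht.2, zero_mul]
  have hw : ∀ t : ℝ, HasDerivAt (fun t : ℝ => (t - ε) * (T - ε - t)) (T - 2 * t) t := by
    intro t
    have := ((hasDerivAt_id t).sub_const ε).mul ((hasDerivAt_id t).const_sub (T - ε))
    refine this.congr_deriv ?_
    simp only [id]; ring
  have hq : ∀ t : ℝ, HasDerivAt (fun t => u t ^ 2 / 2) (u' t * u t) t := by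
    intro t
    refine (((hu t).pow 2).div_const 2).congr_deriv ?_
    simp; ring
  have hw' : Continuous fun t : ℝ => T - 2 * t := by fun_prop
  rw [h1, intervalIntegral.integral_mul_deriv_eq_deriv_mul (fun t _ => hw t) (fun t _ => hq t)
    (hw'.intervalIntegrable _ _) ((hu'.mul hc).intervalIntegrable _ _)]
  simp only [sub_self, mul_zero, zero_mul, zero_sub]
  rw [← intervalIntegral.integral_neg, intervalIntegral.integral_of_le hεT.le,
    integral_Ioc_eq_integral_Ioo, ← integral_const_mul]
  calc ∫ t in Ioo ε (T - ε), -((T - 2 * t) * (u t ^ 2 / 2))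
      ≤ ∫ t in Ioo ε (T - ε), T / 2 * u t ^ 2 := by
        refine setIntegral_mono_on ?_ ?_ measurableSet_Ioo fun t ht => ?_
        · exact ((hw'.mul ((hc.pow 2).div_const 2)).neg.integrableOn_Icc).mono_set
            Ioo_subset_Icc_self
        · exact (IntegrableOn.mono_set (t := Ioo 0 T) hint hsub).const_mul _
        · have := hsub ht
          nlinarith [sq_nonneg (u t), this.2]
    _ ≤ _ := setIntegral_mono_set (hint.const_mul _)
        (Eventually.of_forall fun t => mul_nonneg (by linarith) (sq_nonneg _)) hsub.eventuallyLE

theorem ae_mem_prod (T : ℝ) : ∀ᵐ p ∂((timeMeasure T).prod μI), p ∈ Ioo 0 T ×ˢ Ioo (0 : ℝ) 1 := by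
  rw [← μQ_eq_prod]
  exact ae_restrict_mem (measurableSet_Ioo.prod measurableSet_Ioo)

variable {a b ξ k : ℝ → ℝ} {l r A a₀ b₀ D T lam ε : ℝ} {v : ℝ → ℝ → ℝ} {vT : ℝ → ℝ}

theorem integrable_timeWeight_mul (hε : 0 ≤ ε) (hεT : ε ≤ T - ε) {F : ℝ × ℝ → ℝ}
    (hF : Integrable F ((timeMeasure T).prod μI)) :
    Integrable (fun p => timeWeight T ε p.1 * F p) ((timeMeasure T).prod μI) := by
  refine hF.bdd_mul (c := T ^ 2)
    ((continuous_timeWeight T ε).comp continuous_fst).aestronglyMeasurable ?_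
  refine Eventually.of_forall fun p => ?_
  rw [Real.norm_of_nonneg (timeWeight_nonneg _ _ _)]
  exact timeWeight_le hε hεT

/-- The bump functions of radius `T / (n + 3)`, a regularising sequence of kernels. -/
noncomputable def timeBump (T : ℝ) (hT : 0 < T) (n : ℕ) :
    ContDiffBump (0 : ℝ) where
  rIn := T / (n + 3) / 2
  rOut := T / (n + 3)
  rIn_pos := by positivity
  rIn_lt_rOut := half_lt_self (by positivity)

namespace NondegenerateCutoff

theorem integrable_coeff_mul_sq (hξ : NondegenerateCutoff a b ξ l r A a₀ b₀ D) {F : ℝ × ℝ → ℝ}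
    (hF : MemLp F 2 ((timeMeasure T).prod μI)) :
    Integrable (fun p => a p.2 * F p ^ 2) ((timeMeasure T).prod μI) := by
  refine hF.integrable_sq.bdd_mul (c := A) (aestronglyMeasurable_μI hξ.continuousOn_a).comp_snd ?_
  filter_upwards [ae_mem_prod T] with p hp
  have := Ioo_subset_Icc_self hp.2
  rw [Real.norm_of_nonneg (hξ.a_nonneg _ this)]
  exact hξ.a_le _ this

theorem sq_div_le (hξ : NondegenerateCutoff a b ξ l r A a₀ b₀ D) (t x : ℝ) :
    0 ≤ timeConv T k (cutVal ξ v) t x ^ 2 / b x ∧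
      timeConv T k (cutVal ξ v) t x ^ 2 / b x ≤ b₀⁻¹ * timeConv T k (cutVal ξ v) t x ^ 2 := by
  by_cases hx : x ∈ Icc l r
  · have hb := hξ.le_b x hx
    refine ⟨div_nonneg (sq_nonneg _) (hξ.b₀_pos.le.trans hb), ?_⟩
    rw [div_eq_inv_mul]
    exact mul_le_mul_of_nonneg_right (inv_anti₀ hξ.b₀_pos hb) (sq_nonneg _)
  · rw [timeConv_cutVal, hξ.eq_zero x hx]; simp

/-- The gradient estimate for the regularised solution, with a constant independent of the
regularisation. -/
theorem integral_timeConv_cutGrad_le (hξ : NondegenerateCutoff a b ξ l r A a₀ b₀ D)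
    (hv : IsAdjointSolution a b lam T vT v) (hε : 0 < ε) (hεT : ε < T - ε) (hk : ContDiff ℝ ∞ k)
    (hc : HasCompactSupport k) (hk0 : ∀ s, 0 ≤ k s) (hk1 : ∫ s, k s = 1)
    (hkε : ∀ s, ε < |s| → k s = 0) :
    Integrable (fun p : ℝ × ℝ => timeWeight T ε p.1 *
        (a p.2 * timeConv T k (cutGrad ξ v) p.1 p.2 ^ 2)) ((timeMeasure T).prod μI) ∧
    ∫ p, timeWeight T ε p.1 * (a p.2 * timeConv T k (cutGrad ξ v) p.1 p.2 ^ 2)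
        ∂((timeMeasure T).prod μI)
      ≤ T ^ 2 * A * (∫ p, cutVal (deriv ξ) v p ^ 2 ∂((timeMeasure T).prod μI))
        + (T ^ 2 * |lam| * b₀⁻¹ + T / 2) * ∫ p, cutVal ξ v p ^ 2 ∂((timeMeasure T).prod μI) := by
  have hT : 0 < T := by linarith
  have hkc := hk.continuous
  have hL := hv.memL2H
  have hdk : ContDiff ℝ 1 (deriv k) :=
    ((contDiff_infty_iff_deriv.1 hk).2).of_le (by simp)
  have hq1 := memLp_cutVal hξ.continuous hξ.abs_le hL
  have hq2 := memLp_cutVal hξ.continuous_deriv hξ.deriv_le hL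
  have hg := hξ.memLp_cutGrad hL
  have hU := memLp_timeConv hkc hc hq1
  have hQ := memLp_timeConv hkc hc hq2
  have hG := memLp_timeConv hkc hc hg
  have hU' := memLp_timeConv hdk.continuous hc.deriv hq1
  have hX := hξ.integrable_coeff_mul_sq hG
  have hY := hξ.integrable_coeff_mul_sq hQ
  have hW : Integrable (fun p : ℝ × ℝ => timeConv T (deriv k) (cutVal ξ v) p.1 p.2 *
      timeConv T k (cutVal ξ v) p.1 p.2) ((timeMeasure T).prod μI) := hU'.integrable_mul hU
  have hZ : Integrable (fun p : ℝ × ℝ => timeConv T k (cutVal ξ v) p.1 p.2 ^ 2 / b p.2)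
      ((timeMeasure T).prod μI) := by
    refine (hU.integrable_sq.const_mul b₀⁻¹).mono' ?_ (Eventually.of_forall fun p => ?_)
    · exact ((hU.1.pow 2).aemeasurable.div
        (aestronglyMeasurable_μI hξ.continuousOn_b).comp_snd.aemeasurable).aestronglyMeasurable
    · rw [Real.norm_of_nonneg (hξ.sq_div_le _ _).1]
      exact (hξ.sq_div_le _ _).2
  have wX := integrable_timeWeight_mul hε.le hεT.le hX
  have wY := integrable_timeWeight_mul hε.le hεT.le hY
  have wZ := integrable_timeWeight_mul hε.le hεT.le hZ
  have wW := integrable_timeWeight_mul hε.le hεT.le hW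
  refine ⟨wX, ?_⟩
  have hsum : ∫ p, timeWeight T ε p.1 * (timeConv T (deriv k) (cutVal ξ v) p.1 p.2 *
      timeConv T k (cutVal ξ v) p.1 p.2) ∂((timeMeasure T).prod μI)
      = (∫ p, timeWeight T ε p.1 * (a p.2 * timeConv T k (cutGrad ξ v) p.1 p.2 ^ 2)
          ∂((timeMeasure T).prod μI))
        - (∫ p, timeWeight T ε p.1 * (a p.2 * timeConv T k (cutVal (deriv ξ) v) p.1 p.2 ^ 2)
          ∂((timeMeasure T).prod μI))
        - lam * ∫ p, timeWeight T ε p.1 * (timeConv T k (cutVal ξ v) p.1 p.2 ^ 2 / b p.2)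
          ∂((timeMeasure T).prod μI) := by
    have wXY := wX.sub' wY
    rw [← integral_const_mul, ← integral_sub wX wY, ← integral_sub wXY (wZ.const_mul _),
      integral_prod _ wW, integral_prod _ (wXY.sub' (wZ.const_mul _))]
    congr 1; ext t
    -- The energy identity is available only on `(ε, T - ε)`, outside which the weight vanishes.
    by_cases ht : t ∈ Ioo ε (T - ε)
    · dsimp only
      rw [integral_const_mul, hξ.energy_identity hv hT hk hc hkε ht, ← integral_const_mul]
      congr 1; ext x; ring
    · simp [timeWeight_eq_zero hεT ht]
  have hparts : ∫ p, timeWeight T ε p.1 * (timeConv T (deriv k) (cutVal ξ v) p.1 p.2 *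
      timeConv T k (cutVal ξ v) p.1 p.2) ∂((timeMeasure T).prod μI)
      ≤ T / 2 * ∫ p, timeConv T k (cutVal ξ v) p.1 p.2 ^ 2 ∂((timeMeasure T).prod μI) := by
    rw [integral_prod_symm _ wW, integral_prod_symm _ hU.integrable_sq, ← integral_const_mul]
    refine integral_mono_ae wW.integral_prod_right
      (hU.integrable_sq.integral_prod_right.const_mul _) ?_
    filter_upwards [hasDerivAt_timeConv (hk.of_le (by simp)) hc hq1,
      hasDerivAt_timeConv hdk hc.deriv hq1] with x h1 h2
    exact integral_timeWeight_mul_le hε hεT h1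
      (continuous_iff_continuousAt.2 fun t => (h2 t).continuousAt)
  have hYle : ∫ p, timeWeight T ε p.1 * (a p.2 * timeConv T k (cutVal (deriv ξ) v) p.1 p.2 ^ 2)
      ∂((timeMeasure T).prod μI) ≤ T ^ 2 * A *
        ∫ p, timeConv T k (cutVal (deriv ξ) v) p.1 p.2 ^ 2 ∂((timeMeasure T).prod μI) := by
    rw [← integral_const_mul]
    refine integral_mono_ae wY (hQ.integrable_sq.const_mul _) ?_
    filter_upwards [ae_mem_prod T] with p hp
    have hx := Ioo_subset_Icc_self hp.2
    rw [mul_assoc]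
    exact mul_le_mul (timeWeight_le hε.le hεT.le)
      (mul_le_mul_of_nonneg_right (hξ.a_le _ hx) (sq_nonneg _))
      (mul_nonneg (hξ.a_nonneg _ hx) (sq_nonneg _)) (sq_nonneg _)
  have hZle : lam * ∫ p, timeWeight T ε p.1 * (timeConv T k (cutVal ξ v) p.1 p.2 ^ 2 / b p.2)
      ∂((timeMeasure T).prod μI) ≤ T ^ 2 * |lam| * b₀⁻¹ *
        ∫ p, timeConv T k (cutVal ξ v) p.1 p.2 ^ 2 ∂((timeMeasure T).prod μI) := by
    have hZ0 : 0 ≤ ∫ p, timeWeight T ε p.1 * (timeConv T k (cutVal ξ v) p.1 p.2 ^ 2 / b p.2)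
        ∂((timeMeasure T).prod μI) :=
      integral_nonneg fun p => mul_nonneg (timeWeight_nonneg _ _ _) (hξ.sq_div_le _ _).1
    have hZ1 : ∫ p, timeWeight T ε p.1 * (timeConv T k (cutVal ξ v) p.1 p.2 ^ 2 / b p.2)
        ∂((timeMeasure T).prod μI) ≤ T ^ 2 * b₀⁻¹ *
          ∫ p, timeConv T k (cutVal ξ v) p.1 p.2 ^ 2 ∂((timeMeasure T).prod μI) := by
      rw [← integral_const_mul]
      refine integral_mono_ae wZ (hU.integrable_sq.const_mul _) ?_
      refine Eventually.of_forall fun p => ?_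
      simp only
      rw [mul_assoc]
      exact mul_le_mul (timeWeight_le hε.le hεT.le) (hξ.sq_div_le _ _).2 (hξ.sq_div_le _ _).1
        (sq_nonneg _)
    calc _ ≤ |lam| * _ := mul_le_mul_of_nonneg_right (le_abs_self lam) hZ0
      _ ≤ |lam| * _ := mul_le_mul_of_nonneg_left hZ1 (abs_nonneg _)
      _ = _ := by ring
  have hA : 0 ≤ A := (hξ.a_nonneg 0 (by simp)).trans (hξ.a_le 0 (by simp))
  have hb₀ := hξ.b₀_pos
  have c1 := mul_le_mul_of_nonneg_left (integral_timeConv_sq_le hkc hc hk0 hk1 hq1)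
    (by positivity : 0 ≤ T ^ 2 * |lam| * b₀⁻¹ + T / 2)
  have c2 := mul_le_mul_of_nonneg_left (integral_timeConv_sq_le hkc hc hk0 hk1 hq2)
    (by positivity : 0 ≤ T ^ 2 * A)
  rw [add_mul] at c1 ⊢
  linarith

/-- The interior gradient estimate: Fatou's lemma removes the regularisation. -/
theorem integral_cutGrad_le (hξ : NondegenerateCutoff a b ξ l r A a₀ b₀ D) (hT : 0 < T)
    (hv : IsAdjointSolution a b lam T vT v) :
    Integrable (fun p : ℝ × ℝ => p.1 * (T - p.1) * (a p.2 * cutGrad ξ v p ^ 2))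
      ((timeMeasure T).prod μI) ∧
    ∫ p, p.1 * (T - p.1) * (a p.2 * cutGrad ξ v p ^ 2) ∂((timeMeasure T).prod μI)
      ≤ T ^ 2 * A * (∫ p, cutVal (deriv ξ) v p ^ 2 ∂((timeMeasure T).prod μI))
        + (T ^ 2 * |lam| * b₀⁻¹ + T / 2) * ∫ p, cutVal ξ v p ^ 2 ∂((timeMeasure T).prod μI) := by
  set M := T ^ 2 * A * (∫ p, cutVal (deriv ξ) v p ^ 2 ∂((timeMeasure T).prod μI))
        + (T ^ 2 * |lam| * b₀⁻¹ + T / 2) * ∫ p, cutVal ξ v p ^ 2 ∂((timeMeasure T).prod μI) with hM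
  have hg := hξ.memLp_cutGrad hv.memL2H
  have hA : 0 ≤ A := (hξ.a_nonneg 0 (by simp)).trans (hξ.a_le 0 (by simp))
  have hb₀ := hξ.b₀_pos
  have hM0 : 0 ≤ M := by
    have h1 : 0 ≤ ∫ p, cutVal (deriv ξ) v p ^ 2 ∂((timeMeasure T).prod μI) :=
      integral_nonneg fun _ => sq_nonneg _
    have h2 : 0 ≤ ∫ p, cutVal ξ v p ^ 2 ∂((timeMeasure T).prod μI) :=
      integral_nonneg fun _ => sq_nonneg _
    positivity
  have hX := hξ.integrable_coeff_mul_sq hg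
  have hX' : Integrable (fun p : ℝ × ℝ => p.1 * (T - p.1) * (a p.2 * cutGrad ξ v p ^ 2))
      ((timeMeasure T).prod μI) := by
    refine (integrable_timeWeight_mul (ε := 0) le_rfl (by linarith) hX).congr ?_
    filter_upwards [ae_mem_prod T] with p hp
    rw [timeWeight, max_eq_left]
    · ring
    · exact mul_nonneg (by linarith [hp.1.1]) (by linarith [hp.1.2])
  refine ⟨hX', ?_⟩
  have hnn : 0 ≤ᵐ[(timeMeasure T).prod μI]
      fun p : ℝ × ℝ => p.1 * (T - p.1) * (a p.2 * cutGrad ξ v p ^ 2) := by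
    filter_upwards [ae_mem_prod T] with p hp
    exact mul_nonneg (mul_nonneg hp.1.1.le (sub_nonneg.2 hp.1.2.le))
      (mul_nonneg (hξ.a_nonneg _ (Ioo_subset_Icc_self hp.2)) (sq_nonneg _))
  rw [← ENNReal.ofReal_le_ofReal_iff hM0, ofReal_integral_eq_lintegral_ofReal hX' hnn]
  set e : ℕ → ℝ := fun n => T / (n + 3) with he
  set κ : ℕ → ℝ → ℝ := fun n => (timeBump T hT n).normed volume with hκ
  set F : ℕ → ℝ × ℝ → ℝ := fun n p => timeWeight T (e n) p.1 *
    (a p.2 * timeConv T (κ n) (cutGrad ξ v) p.1 p.2 ^ 2) with hF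
  have he0 : ∀ n, 0 < e n := fun n => by positivity
  have heT : ∀ n, e n < T - e n := by
    intro n
    have : e n * (n + 3) = T := by simp only [he]; field_simp
    have h3 : (0 : ℝ) ≤ n := Nat.cast_nonneg n
    nlinarith [he0 n]
  have helim : Tendsto e atTop (𝓝 0) := by
    refine tendsto_const_nhds.div_atTop ?_
    exact tendsto_atTop_add_const_right _ _ tendsto_natCast_atTop_atTop
  have hFn : ∀ n, Integrable (F n) ((timeMeasure T).prod μI) ∧
      ∫ p, F n p ∂((timeMeasure T).prod μI) ≤ M := by
    intro n
    refine hξ.integral_timeConv_cutGrad_le hv (he0 n) (heT n) (ContDiffBump.contDiff_normed _)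
      (ContDiffBump.hasCompactSupport_normed _) (ContDiffBump.nonneg_normed _)
      (ContDiffBump.integral_normed _) fun s hs => ?_
    have : s ∉ Function.support ((timeBump T hT n).normed volume) := by
      rw [ContDiffBump.support_normed_eq, Metric.mem_ball, dist_zero_right, Real.norm_eq_abs,
        not_lt]
      exact hs.le
    simpa using this
  have hF0 : ∀ n, 0 ≤ᵐ[(timeMeasure T).prod μI] F n := by
    intro n
    filter_upwards [ae_mem_prod T] with p hp
    exact mul_nonneg (timeWeight_nonneg _ _ _)
      (mul_nonneg (hξ.a_nonneg _ (Ioo_subset_Icc_self hp.2)) (sq_nonneg _))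
  have hFle : ∀ n, ∫⁻ x, ∫⁻ t, ENNReal.ofReal (F n (t, x)) ∂(timeMeasure T) ∂μI
      ≤ ENNReal.ofReal M := by
    intro n
    rw [← lintegral_prod_symm _ (hFn n).1.1.aemeasurable.ennreal_ofReal,
      ← ofReal_integral_eq_lintegral_ofReal (hFn n).1 (hF0 n)]
    exact ENNReal.ofReal_le_ofReal (hFn n).2
  have hlim : ∀ᵐ x ∂μI, ∀ᵐ t ∂(timeMeasure T), Tendsto (fun n => ENNReal.ofReal (F n (t, x))) atTop
      (𝓝 (ENNReal.ofReal (t * (T - t) * (a x * cutGrad ξ v (t, x) ^ 2)))) := by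
    have hr : ∀ n, (timeBump T hT n).rOut ≤ 2 * (timeBump T hT n).rIn := fun n => by
      change T / (n + 3) ≤ 2 * (T / (n + 3) / 2)
      linarith
    filter_upwards [tendsto_timeConv (φ := timeBump T hT) hg helim hr] with x hx
    filter_upwards [hx, ae_restrict_mem measurableSet_Ioo] with t ht htm
    refine ENNReal.tendsto_ofReal (Tendsto.mul ?_ ((ht.pow 2).const_mul _))
    have h1 : Tendsto (fun n => max ((t - e n) * (T - e n - t)) 0) atTop
        (𝓝 (max ((t - 0) * (T - 0 - t)) 0)) :=
      ((tendsto_const_nhds.sub helim).mul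
        ((tendsto_const_nhds.sub helim).sub tendsto_const_nhds)).max tendsto_const_nhds
    rwa [sub_zero, sub_zero, max_eq_left (mul_nonneg htm.1.le (sub_nonneg.2 htm.2.le))] at h1
  rw [lintegral_prod_symm _ hX'.1.aemeasurable.ennreal_ofReal]
  have hmeas : ∀ᵐ x ∂μI, ∀ n, AEMeasurable (fun t => ENNReal.ofReal (F n (t, x)))
      (timeMeasure T) := by
    rw [ae_all_iff]
    intro n
    filter_upwards [(hFn n).1.prod_left_ae] with x hx
    exact hx.1.aemeasurable.ennreal_ofReal
  calc ∫⁻ x, ∫⁻ t, ENNReal.ofReal (t * (T - t) * (a x * cutGrad ξ v (t, x) ^ 2))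
        ∂(timeMeasure T) ∂μI
      ≤ ∫⁻ x, liminf (fun n => ∫⁻ t, ENNReal.ofReal (F n (t, x)) ∂(timeMeasure T)) atTop ∂μI := by
        refine lintegral_mono_ae ?_
        filter_upwards [hlim, hmeas] with x hx hm
        rw [lintegral_congr_ae (hx.mono fun t ht => ht.liminf_eq.symm)]
        exact lintegral_liminf_le' hm
    _ ≤ liminf (fun n => ∫⁻ x, ∫⁻ t, ENNReal.ofReal (F n (t, x)) ∂(timeMeasure T) ∂μI) atTop :=
        lintegral_liminf_le' fun n =>
          (hFn n).1.1.aemeasurable.ennreal_ofReal.lintegral_prod_left'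
    _ ≤ ENNReal.ofReal M := by
        refine (liminf_le_liminf (Eventually.of_forall hFle)).trans ?_
        simp

end NondegenerateCutoff

end SingularDegenerate

/-! ### The cutoff function and the exponential weight -/

namespace SingularDegenerate

theorem IsDegenerate.continuousOn {p : ℝ≥0∞} {x₀ K : ℝ} {a : ℝ → ℝ} (h : IsDegenerate p x₀ K a) :
    ContinuousOn a (Icc 0 1) := by
  simpa [uIcc_of_le] using h.sobolev.ac.continuousOn

/-- In all the cases of the standing hypothesis the coefficients are continuous and vanish at `x₀`
only. -/
theorem StandingHyp.exists_isDegenerate {a b : ℝ → ℝ} {x₀ lam : ℝ} (h : StandingHyp a b x₀ lam) :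
    (∃ p K, IsDegenerate p x₀ K a) ∧ ∃ p K, IsDegenerate p x₀ K b := by
  obtain ⟨-, -, ⟨K₁, K₂, h, -⟩ | ⟨K₁, K₂, h, -⟩⟩ := h
  · rcases h with h | h | h <;> exact ⟨⟨_, _, h.1.1⟩, ⟨_, _, h.2.1⟩⟩
  · rcases h with h | h | h | h <;> exact ⟨⟨_, _, h.1.1⟩, ⟨_, _, h.2.1⟩⟩

/-- There is a smooth function equal to `1` on `[α', β']` and supported in a slightly larger
interval, which avoids a given point outside `[α', β']`. -/
theorem exists_smooth_cutoff {α β α' β' x₀ : ℝ} (h' : α' < β') (hα : α < α') (hβ : β' < β)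
    (hx₀ : x₀ ∉ Icc α' β') :
    ∃ (ξ : ℝ → ℝ) (l r : ℝ), ContDiff ℝ ∞ ξ ∧ HasCompactSupport ξ ∧ α < l ∧ r < β ∧ x₀ ∉ Icc l r ∧
      Icc α' β' ⊆ Icc l r ∧ (∀ x ∈ Icc α' β', ξ x = 1) ∧ (∀ x ∉ Icc l r, ξ x = 0) ∧
      (∀ x ∉ Icc l r, deriv ξ x = 0) ∧ ∀ x, |ξ x| ≤ 1 := by
  obtain ⟨d, hd, hdα, hdβ, hdx⟩ :
      ∃ d > 0, α < α' - d ∧ β' + d < β ∧ x₀ ∉ Icc (α' - d) (β' + d) := by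
    rw [mem_Icc, not_and_or, not_le, not_le] at hx₀
    rcases hx₀ with h | h
    · refine ⟨min (min (α' - α) (β - β')) (α' - x₀) / 2, ?_, ?_, ?_, fun hm => ?_⟩
      · have : 0 < min (min (α' - α) (β - β')) (α' - x₀) := by
          simp only [lt_min_iff]; exact ⟨⟨by linarith, by linarith⟩, by linarith⟩
        linarith
      · have : min (min (α' - α) (β - β')) (α' - x₀) ≤ α' - α := by simp
        linarith
      · have : min (min (α' - α) (β - β')) (α' - x₀) ≤ β - β' := by simp
        linarith
      · have : min (min (α' - α) (β - β')) (α' - x₀) ≤ α' - x₀ := min_le_right _ _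
        linarith [hm.1]
    · refine ⟨min (min (α' - α) (β - β')) (x₀ - β') / 2, ?_, ?_, ?_, fun hm => ?_⟩
      · have : 0 < min (min (α' - α) (β - β')) (x₀ - β') := by
          simp only [lt_min_iff]; exact ⟨⟨by linarith, by linarith⟩, by linarith⟩
        linarith
      · have : min (min (α' - α) (β - β')) (x₀ - β') ≤ α' - α := by simp
        linarith
      · have : min (min (α' - α) (β - β')) (x₀ - β') ≤ β - β' := by simp
        linarith
      · have : min (min (α' - α) (β - β')) (x₀ - β') ≤ x₀ - β' := min_le_right _ _
        linarith [hm.2]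
  let φ : ContDiffBump ((α' + β') / 2) :=
    ⟨(β' - α') / 2, (β' - α') / 2 + d, by linarith, by linarith⟩
  have ht : tsupport φ = Icc (α' - d) (β' + d) := by
    rw [φ.tsupport_eq, Real.closedBall_eq_Icc]
    change Icc ((α' + β') / 2 - ((β' - α') / 2 + d)) ((α' + β') / 2 + ((β' - α') / 2 + d)) = _
    congr 1 <;> ring
  refine ⟨φ, α' - d, β' + d, φ.contDiff, φ.hasCompactSupport, hdα, hdβ, hdx,
    Icc_subset_Icc (by linarith) (by linarith), fun x hx => ?_, fun x hx => ?_, fun x hx => ?_,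
    fun x => ?_⟩
  · refine φ.one_of_mem_closedBall ?_
    rw [Real.closedBall_eq_Icc]
    change x ∈ Icc ((α' + β') / 2 - (β' - α') / 2) ((α' + β') / 2 + (β' - α') / 2)
    convert hx using 2 <;> ring
  · exact image_eq_zero_of_notMem_tsupport (ht ▸ hx)
  · by_contra hne
    exact hx (ht ▸ support_deriv_subset (f := φ) hne)
  · rw [abs_of_nonneg φ.nonneg]; exact φ.le_one

theorem exists_pos_le_of_continuousOn {h : ℝ → ℝ} {l r : ℝ} (hh : ContinuousOn h (Icc l r))
    (hp : ∀ x ∈ Icc l r, 0 < h x) : ∃ c, 0 < c ∧ ∀ x ∈ Icc l r, c ≤ h x :=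
  isCompact_Icc.exists_forall_le' hh hp

theorem exists_nondegenerateCutoff {a b : ℝ → ℝ} {x₀ lam α β α' β' : ℝ}
    (hyp : StandingHyp a b x₀ lam) (hω : 0 ≤ α ∧ β ≤ 1) (hω' : α' < β') (hsub : α < α' ∧ β' < β)
    (hx₀ : x₀ ∉ Icc α' β') :
    ∃ ξ l r A a₀ b₀ D, NondegenerateCutoff a b ξ l r A a₀ b₀ D ∧ Icc l r ⊆ Ioo α β ∧
      Icc α' β' ⊆ Icc l r ∧ ∀ x ∈ Icc α' β', ξ x = 1 := by
  obtain ⟨⟨_, _, ha⟩, ⟨_, _, hb⟩⟩ := hyp.exists_isDegenerate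
  obtain ⟨ξ, l, r, hs, hcs, hl, hr, hx, hsubI, h1, h0, h0', habs⟩ :=
    exists_smooth_cutoff hω' hsub.1 hsub.2 hx₀
  have hlr : Icc l r ⊆ Icc (0 : ℝ) 1 := Icc_subset_Icc (by linarith) (by linarith)
  obtain ⟨A, hA⟩ := isCompact_Icc.exists_bound_of_continuousOn ha.continuousOn
  obtain ⟨a₀, ha₀, hale⟩ := exists_pos_le_of_continuousOn (ha.continuousOn.mono hlr) fun x hxm =>
    ha.pos x (hlr hxm) fun e => hx (e ▸ hxm)
  obtain ⟨b₀, hb₀, hble⟩ := exists_pos_le_of_continuousOn (hb.continuousOn.mono hlr) fun x hxm =>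
    hb.pos x (hlr hxm) fun e => hx (e ▸ hxm)
  obtain ⟨D, hD⟩ := hcs.deriv.exists_bound_of_continuous (hs.continuous_deriv (by simp))
  refine ⟨ξ, l, r, A, a₀, b₀, D, ⟨hs, by linarith, by linarith, h0, h0', habs, hD, ha.continuousOn,
    hb.continuousOn, fun x hxm => ?_, fun x hxm => (le_abs_self _).trans (hA x hxm), ha₀, hb₀, hale,
    hble⟩, fun x hxm => ⟨hl.trans_le hxm.1, hxm.2.trans_lt hr⟩, hsubI, h1⟩
  rcases eq_or_ne x x₀ with rfl | hne
  · exact ha.zero.ge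
  · exact (ha.pos x hxm hne).le

/-- As `Θ` blows up at both ends of `(0,T)`, the exponential weight is dominated by `t (T - t)`,
uniformly for `s ≥ 1`. -/
theorem exp_weight_le {T t m s y : ℝ} (ht : t ∈ Ioo 0 T) (hm : 0 < m) (hs : 1 ≤ s) (hy : y ≤ -m) :
    Real.exp (2 * s * (Theta T t * y)) ≤ T ^ 6 / (2 * m) * (t * (T - t)) := by
  have h1 : 0 < T - t := sub_pos.2 ht.2
  set z := t * (T - t) with hz
  have hz0 : 0 < z := mul_pos ht.1 h1
  have hzT : z ≤ T ^ 2 := by nlinarith [ht.1]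
  have hΘ : 0 < Theta T t := by rw [Theta]; positivity
  have hle : 2 * s * (Theta T t * y) ≤ -(2 * m * Theta T t) := by
    have h2 : Theta T t * y ≤ -(m * Theta T t) := by nlinarith
    nlinarith [mul_pos hm hΘ]
  have hpos : 0 < 2 * m * Theta T t := by positivity
  calc Real.exp (2 * s * (Theta T t * y)) ≤ Real.exp (-(2 * m * Theta T t)) :=
        Real.exp_le_exp.2 hle
    _ ≤ (2 * m * Theta T t)⁻¹ := by
        rw [Real.exp_neg]
        exact inv_anti₀ hpos (by linarith [Real.add_one_le_exp (2 * m * Theta T t)])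
    _ = z ^ 3 / (2 * m) * z := by
        rw [Theta, ← hz]; field_simp
    _ ≤ T ^ 6 / (2 * m) * z := by
        have : z ^ 3 ≤ T ^ 6 := by
          calc z ^ 3 ≤ (T ^ 2) ^ 3 := pow_le_pow_left₀ hz0.le hzT 3
            _ = T ^ 6 := by ring
        gcongr

theorem integral_cutVal_sq_le {a b ζ : ℝ → ℝ} {T C l r α β : ℝ} {v : ℝ → ℝ → ℝ}
    (hv : MemL2H a b T v) (hω : 0 ≤ α ∧ β ≤ 1) (hlr : Icc l r ⊆ Ioo α β) (hζ : Continuous ζ)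
    (hC : ∀ x, |ζ x| ≤ C) (h0 : ∀ x ∉ Icc l r, ζ x = 0) :
    ∫ p, cutVal ζ v p ^ 2 ∂((timeMeasure T).prod μI)
      ≤ C ^ 2 * ∫ t in Ioo 0 T, ∫ x in Ioo α β, v t x ^ 2 := by
  have hL := hv.memLp
  rw [μQ_eq_prod] at hL
  have hωI : Ioo α β ⊆ Ioo (0 : ℝ) 1 := Ioo_subset_Ioo hω.1 hω.2
  have hle : (timeMeasure T).prod (volume.restrict (Ioo α β)) ≤ (timeMeasure T).prod μI :=
    Measure.prod_mono le_rfl (Measure.restrict_mono hωI le_rfl)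
  have heq : (timeMeasure T).prod (volume.restrict (Ioo α β))
      = ((timeMeasure T).prod μI).restrict (univ ×ˢ Ioo α β) := by
    rw [← Measure.prod_restrict, Measure.restrict_univ, μI,
      Measure.restrict_restrict measurableSet_Ioo, inter_eq_self_of_subset_left hωI]
  have hcv := (memLp_cutVal hζ hC hv).integrable_sq
  rw [← integral_prod (fun p : ℝ × ℝ => v p.1 p.2 ^ 2) (hL.integrable_sq.mono_measure hle), heq,
    ← setIntegral_univ, ← integral_const_mul,
    setIntegral_eq_of_subset_of_forall_sdiff_eq_zero (s := univ ×ˢ Ioo α β) MeasurableSet.univ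
      (subset_univ _)]
  · refine integral_mono hcv.restrict (hL.integrable_sq.restrict.const_mul _) fun p => ?_
    simp only [cutVal, mul_pow]
    refine mul_le_mul_of_nonneg_right ?_ (sq_nonneg _)
    rw [← sq_abs]
    exact pow_le_pow_left₀ (abs_nonneg _) (hC _) 2
  · intro p hp
    have : p.2 ∉ Icc l r := fun h => hp.2 ⟨mem_univ _, hlr h⟩
    simp [cutVal, h0 _ this]

end SingularDegenerate

/-! ### Caccioppoli's inequality -/

theorem proposition4p2 (a b : ℝ → ℝ) (x₀ lam T : ℝ)
    (hT : 0 < T)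
    (hyp : SingularDegenerate.StandingHyp a b x₀ lam)
    (α β α' β' : ℝ)
    -- `ω = (α, β)` and `ω' = (α', β')`
    (hω : 0 ≤ α ∧ β ≤ 1) (hω' : α' < β') (hsub : α < α' ∧ β' < β) (hx₀ : x₀ ∉ Icc α' β')
    (Υ : ℝ → ℝ)
    (hΥ_cont : ContinuousOn Υ (Icc 0 1))
    (hΥ_neg : ∀ x ∈ Icc (0 : ℝ) 1, Υ x < 0)
    (hΥ_C1 : ContDiffOn ℝ 1 Υ (Icc 0 1 \ {x₀}))
    (hΥ_bound : ∃ c : ℝ, 0 < c ∧ ∀ x ∈ Icc (0 : ℝ) 1 \ {x₀},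
      |derivWithin Υ (Icc 0 1 \ {x₀}) x| ≤ c / √(a x)) :
    ∃ C s₀ : ℝ, 0 < C ∧ 0 < s₀ ∧
      ∀ v ∈ SingularDegenerate.classW a b lam T, ∀ s : ℝ, s₀ ≤ s →
        IntegrableOn (fun q : ℝ × ℝ => deriv (v q.1) q.2 ^ 2 *
            Real.exp (2 * s * (SingularDegenerate.Theta T q.1 * Υ q.2)))
          (Ioo 0 T ×ˢ Ioo α' β') ∧
        ∫ t in Ioo 0 T, ∫ x in Ioo α' β', deriv (v t) x ^ 2 *
            Real.exp (2 * s * (SingularDegenerate.Theta T t * Υ x))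
          ≤ C * ∫ t in Ioo 0 T, ∫ x in Ioo α β, v t x ^ 2 := by
  open SingularDegenerate in
  obtain ⟨ξ, l, r, A, a₀, b₀, D, hξ, hlr, hsubI, hξ1⟩ :=
    exists_nondegenerateCutoff hyp hω hω' hsub hx₀
  obtain ⟨m, hm, hΥm⟩ := exists_pos_le_of_continuousOn hΥ_cont.neg
    fun x hx => neg_pos.2 (hΥ_neg x hx)
  have hA : 0 ≤ A := (hξ.a_nonneg 0 (by simp)).trans (hξ.a_le 0 (by simp))
  have ha₀ := hξ.a₀_pos
  have hb₀ := hξ.b₀_pos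
  set c : ℝ := T ^ 6 / (2 * m) / a₀ with hc
  have hc0 : 0 < c := by positivity
  set M : ℝ := T ^ 2 * A * D ^ 2 + (T ^ 2 * |lam| * b₀⁻¹ + T / 2) with hM
  refine ⟨c * M, 1, by positivity, one_pos, ?_⟩
  rintro v ⟨vT, -, hv⟩ s hs
  have hL := hv.memL2H
  have hI'01 : Ioo α' β' ⊆ Ioo (0 : ℝ) 1 := Ioo_subset_Ioo (by linarith) (by linarith)
  have hS : MeasurableSet (Ioo 0 T ×ˢ Ioo α' β') := measurableSet_Ioo.prod measurableSet_Ioo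
  have hrestr : (volume : Measure (ℝ × ℝ)).restrict (Ioo 0 T ×ˢ Ioo α' β')
      = ((timeMeasure T).prod μI).restrict (Ioo 0 T ×ˢ Ioo α' β') := by
    rw [← μQ_eq_prod, μQ, Measure.restrict_restrict hS,
      inter_eq_self_of_subset_left (prod_mono le_rfl hI'01)]
  -- The cutoff is constant on `ω'`, so that `(ξ v)_x = v_x` there.
  have hgrad : ∀ q ∈ Ioo 0 T ×ˢ Ioo α' β', cutGrad ξ v q = deriv (v q.1) q.2 := by
    rintro q ⟨-, hq⟩
    have hd : deriv ξ q.2 = 0 := by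
      have : ξ =ᶠ[𝓝 q.2] fun _ => 1 := by
        filter_upwards [isOpen_Ioo.mem_nhds hq] with x hx
        exact hξ1 x (Ioo_subset_Icc_self hx)
      rw [this.deriv_eq, deriv_const]
    simp [cutGrad, cutVal, cutDeriv, hd, hξ1 _ (Ioo_subset_Icc_self hq)]
  obtain ⟨hGi, hGle⟩ := hξ.integral_cutGrad_le hT hv
  have hbound : ∀ q ∈ Ioo 0 T ×ˢ Ioo α' β',
      deriv (v q.1) q.2 ^ 2 * Real.exp (2 * s * (Theta T q.1 * Υ q.2))
        ≤ c * (q.1 * (T - q.1) * (a q.2 * cutGrad ξ v q ^ 2)) := by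
    intro q hq
    have hx := hsubI (Ioo_subset_Icc_self hq.2)
    have hz : 0 ≤ q.1 * (T - q.1) := mul_nonneg hq.1.1.le (sub_nonneg.2 hq.1.2.le)
    have hyle : Υ q.2 ≤ -m := by
      have := hΥm q.2 (Ioo_subset_Icc_self (hI'01 hq.2))
      simp only [Pi.neg_apply] at this
      linarith
    rw [hgrad q hq]
    calc _ ≤ deriv (v q.1) q.2 ^ 2 * (T ^ 6 / (2 * m) * (q.1 * (T - q.1))) :=
          mul_le_mul_of_nonneg_left (exp_weight_le hq.1 hm hs hyle) (sq_nonneg _)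
      _ = c * (q.1 * (T - q.1) * (a₀ * deriv (v q.1) q.2 ^ 2)) := by
          rw [hc]; field_simp
      _ ≤ _ := by
          have := hξ.le_a _ hx
          gcongr
  have hint : IntegrableOn (fun q : ℝ × ℝ => deriv (v q.1) q.2 ^ 2 *
      Real.exp (2 * s * (Theta T q.1 * Υ q.2))) (Ioo 0 T ×ˢ Ioo α' β') := by
    have hΥ : AEStronglyMeasurable (fun q : ℝ × ℝ => Υ q.2)
        (volume.restrict (Ioo 0 T ×ˢ Ioo α' β')) := by
      rw [hrestr]
      exact (aestronglyMeasurable_μI hΥ_cont).comp_snd.restrict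
    have hΘ : Measurable fun q : ℝ × ℝ => Theta T q.1 := by unfold Theta; fun_prop
    have hg : AEStronglyMeasurable (fun q : ℝ × ℝ => deriv (v q.1) q.2)
        (volume.restrict (Ioo 0 T ×ˢ Ioo α' β')) := by
      have := (hξ.memLp_cutGrad hL).1.restrict (s := Ioo 0 T ×ˢ Ioo α' β')
      rw [← hrestr] at this
      refine this.congr ?_
      filter_upwards [ae_restrict_mem hS] with q hq
      exact hgrad q hq
    refine Integrable.mono' (g := fun q => c * (q.1 * (T - q.1) * (a q.2 * cutGrad ξ v q ^ 2)))
      ?_ ?_ ?_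
    · rw [hrestr]
      exact (hGi.const_mul c).restrict
    · exact (hg.pow 2).mul (Real.continuous_exp.comp_aestronglyMeasurable
        ((hΘ.aestronglyMeasurable.mul hΥ).const_mul _))
    · filter_upwards [ae_restrict_mem hS] with q hq
      rw [Real.norm_of_nonneg (by positivity)]
      exact hbound q hq
  refine ⟨hint, ?_⟩
  have hprod : (volume : Measure (ℝ × ℝ)).restrict (Ioo 0 T ×ˢ Ioo α' β')
      = (timeMeasure T).prod (volume.restrict (Ioo α' β')) := by
    rw [Measure.prod_restrict, Measure.volume_eq_prod]
  have hint' := hint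
  rw [IntegrableOn, hprod] at hint'
  have h2 := integral_cutVal_sq_le hL hω hlr hξ.continuous_deriv hξ.deriv_le hξ.deriv_eq_zero
  have h1 := integral_cutVal_sq_le hL hω hlr hξ.continuous hξ.abs_le hξ.eq_zero
  calc _ = ∫ q in Ioo 0 T ×ˢ Ioo α' β', deriv (v q.1) q.2 ^ 2 *
        Real.exp (2 * s * (Theta T q.1 * Υ q.2)) := by
        rw [hprod, integral_prod _ hint']
    _ ≤ ∫ q in Ioo 0 T ×ˢ Ioo α' β', c * (q.1 * (T - q.1) * (a q.2 * cutGrad ξ v q ^ 2))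
          ∂((timeMeasure T).prod μI) := by
        rw [← hrestr]
        refine setIntegral_mono_on hint ?_ hS hbound
        rw [IntegrableOn, hrestr]
        exact (hGi.const_mul c).restrict
    _ ≤ ∫ q, c * (q.1 * (T - q.1) * (a q.2 * cutGrad ξ v q ^ 2)) ∂((timeMeasure T).prod μI) := by
        refine setIntegral_le_integral (hGi.const_mul c) ?_
        filter_upwards [ae_mem_prod T] with q hq
        exact mul_nonneg hc0.le (mul_nonneg (mul_nonneg hq.1.1.le (sub_nonneg.2 hq.1.2.le))
          (mul_nonneg (hξ.a_nonneg _ (Ioo_subset_Icc_self hq.2)) (sq_nonneg _)))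
    _ ≤ c * M * ∫ t in Ioo 0 T, ∫ x in Ioo α β, v t x ^ 2 := by
        rw [integral_const_mul, mul_assoc]
        refine mul_le_mul_of_nonneg_left (hGle.trans ?_) hc0.le
        have e2 := mul_le_mul_of_nonneg_left h2 (by positivity : 0 ≤ T ^ 2 * A)
        have e1 := mul_le_mul_of_nonneg_left h1
          (by positivity : 0 ≤ T ^ 2 * |lam| * b₀⁻¹ + T / 2)
        rw [hM]
        linarith
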